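/- **Conventions.** All fields have characteristic zero; rings are commutative with $1$. A difference ring is a ring with an automorphism $\sigma$, its constants are $C_R=\{x\in R:\sigma(x)=x\}$, and difference ring extensions and homomorphisms are compatible with $\sigma$. Let $K$ be a difference field and $A\in\mathrm{GL}_n(K)$. A *Picard-Vessiot ring* for $\sigma Y=AY$ over $K$ is a difference ring extension $R=K[Z,1/\det Z]$ of $K$ with $Z\in\mathrm{GL}_n(R)$, $\sigma Z=AZ$, which is nonzero and has no $\sigma$-invariant ideals other than $0$ and $R$. A *weak Picard-Vessiot ring* is a nonzero difference ring extension of the same form $R=K[Z,1/\det Z]$ with $C_R=C_K$ in place of the condition on ideals. A *weak Picard-Vessiot field* is a difference field extension $L$ of $K$ with $C_L=C_K$ that is the quotient field of a weak Picard-Vessiot ring. For a difference ring extension $R$ of $K$, the *Galois group* $G_R$ is the group functor on $C_K$-algebras that sends $B$ to the group of $K\otimes_{C_K}B$-linear automorphisms of $R\otimes_{C_K}B$ commuting with $\sigma$, where $\sigma(r\otimes b)=\sigma(r)\otimes b$. **Theorem.** Let $k$ be a difference field whose field of constants $C=C_k$ is algebraically closed, let $A\in\mathrm{GL}_n(k)$,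 and let $R$ be a Picard-Vessiot ring for $\sigma Y=AY$ over $k$. Let $K$ be a difference field extension of $k$ with $K=k(C_K)$, let $\overline{C}_K$ be an algebraic closure of $C_K$, and let $L$ be a weak Picard-Vessiot field for $\sigma Y=AY$ over $K$, written $L=K(V)$ with $V\in\mathrm{GL}_n(L)$ and $\sigma V=AV$. Put $T=K[V,1/\det V]\subset L$. Then: (a) There is an isomorphism of rings $$\Phi:\ (K\otimes_k R)\otimes_{C_K}\overline{C}_K\ \xrightarrow{\ \sim\ }\ T\otimes_{C_K}\overline{C}_K$$ which is linear over $K$ and over $\overline{C}_K$ and commutes with $\sigma$ (acting on $K\otimes_k R$ by $\sigma\otimes\sigma$ and trivially on $\overline{C}_K$). Moreover, $r\otimes c\mapsto\Phi((1\otimes r)\otimes c)$ is an injective ring homomorphism $R\otimes_C\overline{C}_K\to T\otimes_{C_K}\overline{C}_K$. Furthermore, $T$ is a Picard-Vessiot ring for $\sigma Y=AY$ over $K$. (b) The Galois groups $G_R$ of $R$ over $k$ and $G_T$ of $T$ over $K$ are linear algebraic groups over $C$ and over $C_K$ respectively (that is, they are represented by finitely generated algebras), and they become isomorphic over $\overline{C}_K$: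 $G_R\times_C\overline{C}_K\simeq G_T\times_{C_K}\overline{C}_K$. -/

import Mathlib

open TensorProduct CategoryTheory

universe u

/-- A difference ring: a commutative ring with a distinguished automorphism `σ`. -/
class DifferenceRing (R : Type*) [CommRing R] where
  /-- the automorphism -/
  σ : R ≃+* R

namespace DifferenceRing

/-- A difference ring extension: the structure map commutes with the automorphisms. -/
class Extension (K R : Type*) [CommRing K] [CommRing R] [DifferenceRing K] [DifferenceRing R]
    [Algebra K R] : Prop where
  σ_algebraMap : ∀ a : K, σ (algebraMap K R a) = algebraMap K R (σ a)

/-- `R` is simple as a difference ring: `0` and `R` are its only `σ`-invariant ideals. -/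
def IsSimple (R : Type*) [CommRing R] [DifferenceRing R] : Prop :=
  Nontrivial R ∧ ∀ I : Ideal R, (∀ x ∈ I, σ x ∈ I) → I = ⊥ ∨ I = ⊤

/-- The field `C_K` of constants of a difference field `K`. -/
def constants (K : Type*) [Field K] [DifferenceRing K] : Subfield K :=
  RingHom.eqLocusField ((σ : K ≃+* K) : K →+* K) (RingHom.id K)

theorem mem_constants {K : Type*} [Field K] [DifferenceRing K] {x : K} :
    x ∈ constants K ↔ σ x = x := Iff.rfl

/-- `C_R = C_K`: every constant of `R` comes from a constant of the difference field `K`. -/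
def NoNewConstants (K R : Type*) [Field K] [DifferenceRing K] [CommRing R] [DifferenceRing R]
    [Algebra K R] : Prop :=
  ∀ x : R, σ x = x → ∃ c ∈ constants K, algebraMap K R c = x

/-- For a difference field extension `K` of `k`, the inclusion `C_k → C_K`. -/
instance constantsAlgebra (k K : Type*) [Field k] [DifferenceRing k] [Field K] [DifferenceRing K]
    [Algebra k K] [Extension k K] : Algebra (constants k) (constants K) :=
  (((algebraMap k K).comp (constants k).subtype).codRestrict (constants K) fun c => by
    rw [mem_constants]
    change σ (algebraMap k K c) = algebraMap k K c
    rw [Extension.σ_algebraMap, mem_constants.1 c.2]).toAlgebra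

/-! ### Solutions of `σ Y = A Y` -/

/-- A fundamental matrix in `R` for the equation `σ Y = A Y` with `A ∈ GL_n(K)`:
a matrix `Z ∈ GL_n(R)` with `σ Z = A Z`. -/
structure FundamentalMatrix {K : Type*} [Field K] {n : ℕ} (A : GL (Fin n) K)
    (R : Type*) [CommRing R] [DifferenceRing R] [Algebra K R] where
  mat : GL (Fin n) R
  map_σ : Matrix.GeneralLinearGroup.map ((σ : R ≃+* R) : R →+* R) mat =
    Matrix.GeneralLinearGroup.map (algebraMap K R) A * mat

namespace FundamentalMatrix

variable {K : Type*} [Field K] {n : ℕ} {A : GL (Fin n) K}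
  {R : Type*} [CommRing R] [DifferenceRing R] [Algebra K R]

/-- The subring `K[Z, 1/det Z]` of `R`. -/
def ring (Z : FundamentalMatrix A R) : Subalgebra K R :=
  Algebra.adjoin K (Set.range (fun p : Fin n × Fin n => Z.mat p.1 p.2) ∪
    {((Matrix.GeneralLinearGroup.det Z.mat)⁻¹ : Rˣ).1})

theorem entry_mem (Z : FundamentalMatrix A R) (i j : Fin n) : Z.mat i j ∈ Z.ring :=
  Algebra.subset_adjoin (Or.inl ⟨(i, j), rfl⟩)

theorem det_inv_mem (Z : FundamentalMatrix A R) :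
    ((Matrix.GeneralLinearGroup.det Z.mat)⁻¹ : Rˣ).1 ∈ Z.ring :=
  Algebra.subset_adjoin (Or.inr rfl)

theorem algebraMap_mul_entry_mem (Z : FundamentalMatrix A R) (B : GL (Fin n) K) (i j : Fin n) :
    (Matrix.GeneralLinearGroup.map (algebraMap K R) B * Z.mat) i j ∈ Z.ring := by
  rw [Units.val_mul, Matrix.mul_apply]
  refine Subalgebra.sum_mem _ fun l _ => Subalgebra.mul_mem _ ?_ (Z.entry_mem l j)
  rw [Matrix.GeneralLinearGroup.map_apply]
  exact Subalgebra.algebraMap_mem _ _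

/-- If a ring automorphism `τ` of `R` preserves `K` and `τ Z = B Z` with `B ∈ GL_n(K)`,
then `τ` maps `K[Z, 1/det Z]` to itself. -/
theorem apply_mem_of_map_eq (Z : FundamentalMatrix A R) (τ : R ≃+* R)
    (hτ : ∀ a : K, ∃ b : K, τ (algebraMap K R a) = algebraMap K R b) (B : GL (Fin n) K)
    (hB : Matrix.GeneralLinearGroup.map (τ : R →+* R) Z.mat =
      Matrix.GeneralLinearGroup.map (algebraMap K R) B * Z.mat) {x : R} (hx : x ∈ Z.ring) :
    τ x ∈ Z.ring := by
  induction hx using Algebra.adjoin_induction with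
  | mem x hx =>
    rcases hx with ⟨p, rfl⟩ | rfl
    · have h := Z.algebraMap_mul_entry_mem B p.1 p.2
      rw [← hB, Matrix.GeneralLinearGroup.map_apply] at h
      exact h
    · have h : Units.map ((τ : R →+* R) : R →* R) (Matrix.GeneralLinearGroup.det Z.mat)⁻¹ =
          Units.map ((algebraMap K R : K →+* R) : K →* R)
            (Matrix.GeneralLinearGroup.det B)⁻¹ * (Matrix.GeneralLinearGroup.det Z.mat)⁻¹ := by
        rw [map_inv, ← Matrix.GeneralLinearGroup.map_det, hB, map_mul,
          Matrix.GeneralLinearGroup.map_det, mul_inv, map_inv]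
      have h' := congrArg Units.val h
      have h2 : τ (((Matrix.GeneralLinearGroup.det Z.mat)⁻¹ : Rˣ).1) =
          algebraMap K R ((Matrix.GeneralLinearGroup.det B)⁻¹ : Kˣ).1 *
            ((Matrix.GeneralLinearGroup.det Z.mat)⁻¹ : Rˣ).1 := h'
      rw [h2]
      exact Subalgebra.mul_mem _ (Subalgebra.algebraMap_mem _ _) Z.det_inv_mem
  | algebraMap a =>
    obtain ⟨b, hb⟩ := hτ a
    rw [hb]
    exact Subalgebra.algebraMap_mem _ _
  | add x y _ _ hx hy => rw [map_add]; exact Subalgebra.add_mem _ hx hy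
  | mul x y _ _ hx hy => rw [map_mul]; exact Subalgebra.mul_mem _ hx hy

variable [DifferenceRing K] [Extension K R]

theorem σ_mem (Z : FundamentalMatrix A R) {x : R} (hx : x ∈ Z.ring) : σ x ∈ Z.ring :=
  Z.apply_mem_of_map_eq σ (fun a => ⟨σ a, Extension.σ_algebraMap a⟩) A Z.map_σ hx

theorem σ_symm_algebraMap (a : K) :
    (σ : R ≃+* R).symm (algebraMap K R a) = algebraMap K R ((σ : K ≃+* K).symm a) := by
  rw [RingEquiv.symm_apply_eq, Extension.σ_algebraMap, RingEquiv.apply_symm_apply]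

theorem σ_symm_mem (Z : FundamentalMatrix A R) {x : R} (hx : x ∈ Z.ring) :
    (σ : R ≃+* R).symm x ∈ Z.ring := by
  refine Z.apply_mem_of_map_eq (σ : R ≃+* R).symm (fun a => ⟨_, σ_symm_algebraMap a⟩)
    (Matrix.GeneralLinearGroup.map (((σ : K ≃+* K).symm : K ≃+* K) : K →+* K) A⁻¹) ?_ hx
  have h := congrArg
    (Matrix.GeneralLinearGroup.map (((σ : R ≃+* R).symm : R ≃+* R) : R →+* R)) Z.map_σ
  rw [map_mul] at h
  have h1 : Matrix.GeneralLinearGroup.map (((σ : R ≃+* R).symm : R ≃+* R) : R →+* R)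
      (Matrix.GeneralLinearGroup.map ((σ : R ≃+* R) : R →+* R) Z.mat) = Z.mat := by
    ext i j
    simp
  have h2 : Matrix.GeneralLinearGroup.map (((σ : R ≃+* R).symm : R ≃+* R) : R →+* R)
      (Matrix.GeneralLinearGroup.map (algebraMap K R) A) =
      Matrix.GeneralLinearGroup.map (algebraMap K R)
        (Matrix.GeneralLinearGroup.map (((σ : K ≃+* K).symm : K ≃+* K) : K →+* K) A) := by
    ext i j
    simp [σ_symm_algebraMap]
  rw [h1, h2] at h
  rw [map_inv, map_inv]
  exact eq_inv_mul_of_mul_eq h.symm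

/-- `K[Z, 1/det Z]` is a difference ring with the restriction of the automorphism of `R`. -/
instance differenceRing (Z : FundamentalMatrix A R) : DifferenceRing Z.ring where
  σ :=
    { toFun := fun x => ⟨σ x.1, Z.σ_mem x.2⟩
      invFun := fun x => ⟨(σ : R ≃+* R).symm x.1, Z.σ_symm_mem x.2⟩
      left_inv := fun _ => Subtype.ext (RingEquiv.symm_apply_apply _ _)
      right_inv := fun _ => Subtype.ext (RingEquiv.apply_symm_apply _ _)
      map_mul' := fun _ _ => Subtype.ext (map_mul _ _ _)
      map_add' := fun _ _ => Subtype.ext (map_add _ _ _) }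

theorem coe_σ (Z : FundamentalMatrix A R) (x : Z.ring) :
    ((σ x : Z.ring) : R) = σ (x : R) := rfl

instance extension (Z : FundamentalMatrix A R) : Extension K Z.ring where
  σ_algebraMap a := Subtype.ext (Extension.σ_algebraMap (K := K) (R := R) a)

end FundamentalMatrix

section PicardVessiot

variable {K : Type*} [Field K] [DifferenceRing K] {n : ℕ} (A : GL (Fin n) K)

/-- A Picard-Vessiot ring for `σ Y = A Y` over the difference field `K`: a simple difference ring
extension of `K` of the form `K[Z, 1/det Z]` with `Z` a fundamental matrix. -/
def IsPicardVessiotRing (R : Type*) [CommRing R] [DifferenceRing R] [Algebra K R]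
    [Extension K R] : Prop :=
  (∃ Z : FundamentalMatrix A R, Z.ring = ⊤) ∧ IsSimple R

/-- A weak Picard-Vessiot ring for `σ Y = A Y` over the difference field `K`: a difference ring
extension of `K` of the form `K[Z, 1/det Z]` with `Z` a fundamental matrix, and without
new constants. It is nonzero, since it contains `K`. -/
def IsWeakPicardVessiotRing (R : Type*) [CommRing R] [DifferenceRing R] [Algebra K R]
    [Extension K R] : Prop :=
  Nontrivial R ∧ (∃ Z : FundamentalMatrix A R, Z.ring = ⊤) ∧ NoNewConstants K R

/-- A weak Picard-Vessiot field for `σ Y = A Y` over the difference field `K`: a difference field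
extension `L` of `K` without new constants which is the quotient field of a weak Picard-Vessiot
ring. A subring of `L` of the form `K[Z, 1/det Z]` is determined by the matrix `Z` in `GL_n(L)`. -/
def IsWeakPicardVessiotField (L : Type*) [Field L] [DifferenceRing L] [Algebra K L]
    [Extension K L] : Prop :=
  NoNewConstants K L ∧
    ∃ Z : FundamentalMatrix A L, IsWeakPicardVessiotRing A Z.ring ∧ IsFractionRing Z.ring L

end PicardVessiot

/-! ### Extension of the base field -/

section BaseChange

variable (k K R : Type*) [Field k] [DifferenceRing k] [Field K] [DifferenceRing K] [Algebra k K]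
  [Extension k K] [CommRing R] [DifferenceRing R] [Algebra k R] [Extension k R]

/-- The automorphism of a difference ring extension of `k`, as a map semilinear over the
automorphism of `k`. -/
def σSemilinear : R →ₛₗ[((σ : k ≃+* k) : k →+* k)] R where
  toFun := σ
  map_add' := map_add _
  map_smul' a x := by
    rw [Algebra.smul_def, map_mul, Extension.σ_algebraMap, Algebra.smul_def]
    rfl

theorem map_σ_mul (x y : K ⊗[k] R) :
    TensorProduct.map (σSemilinear k K) (σSemilinear k R) (x * y) =
      TensorProduct.map (σSemilinear k K) (σSemilinear k R) x *
        TensorProduct.map (σSemilinear k K) (σSemilinear k R) y := by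
  induction x with
  | zero => simp
  | add x₁ x₂ h₁ h₂ => rw [add_mul, map_add, h₁, h₂, map_add, add_mul]
  | tmul a r =>
    induction y with
    | zero => simp
    | add y₁ y₂ h₁ h₂ => rw [mul_add, map_add, h₁, h₂, map_add, mul_add]
    | tmul b s => simp [σSemilinear]

/-- The ring endomorphism `a ⊗ r ↦ σ a ⊗ σ r` of `K ⊗_k R`. -/
def σTensorHom : K ⊗[k] R →+* K ⊗[k] R where
  toFun := TensorProduct.map (σSemilinear k K) (σSemilinear k R)
  map_one' := by simp [Algebra.TensorProduct.one_def, σSemilinear]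
  map_mul' := map_σ_mul k K R
  map_zero' := map_zero _
  map_add' := map_add _

theorem σTensorHom_tmul (a : K) (r : R) :
    σTensorHom k K R (a ⊗ₜ r) = (σ a) ⊗ₜ (σ r) := rfl

theorem σTensorHom_bijective : Function.Bijective (σTensorHom k K R) := by
  let _ : RingHomInvPair ((σ : k ≃+* k) : k →+* k) (((σ : k ≃+* k).symm : k ≃+* k) : k →+* k) :=
    RingHomInvPair.of_ringEquiv σ
  let inv (M : Type _) [CommRing M] [DifferenceRing M] [Algebra k M] [Extension k M] :
      M →ₛₗ[(((σ : k ≃+* k).symm : k ≃+* k) : k →+* k)] M :=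
    { toFun := (σ : M ≃+* M).symm
      map_add' := map_add _
      map_smul' := fun a x => by
        rw [RingEquiv.symm_apply_eq, Algebra.smul_def, Algebra.smul_def, map_mul,
          Extension.σ_algebraMap, RingEquiv.apply_symm_apply]
        simp }
  let invK : K →ₛₗ[(((σ : k ≃+* k).symm : k ≃+* k) : k →+* k)] K :=
    { toFun := (σ : K ≃+* K).symm
      map_add' := map_add _
      map_smul' := fun a x => by
        rw [RingEquiv.symm_apply_eq, Algebra.smul_def, Algebra.smul_def, map_mul,
          Extension.σ_algebraMap, RingEquiv.apply_symm_apply]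
        simp }
  refine Function.bijective_iff_has_inverse.2 ⟨TensorProduct.map invK (inv R), ?_, ?_⟩
  · intro x
    induction x with
    | zero => simp
    | add x y hx hy => rw [map_add, map_add, hx, hy]
    | tmul a r => simp [σTensorHom_tmul, invK, inv]
  · intro x
    induction x with
    | zero => simp
    | add x y hx hy => rw [map_add, map_add, hx, hy]
    | tmul a r => simp [σTensorHom_tmul, invK, inv]

/-- The extension `K ⊗_k R` of the base field of `R` from `k` to `K`. -/
def BaseChange : Type _ := K ⊗[k] R

namespace BaseChange

noncomputable instance : CommRing (BaseChange k K R) := inferInstanceAs (CommRing (K ⊗[k] R))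

noncomputable instance : Algebra K (BaseChange k K R) := inferInstanceAs (Algebra K (K ⊗[k] R))

/-- `K ⊗_k R` is a difference ring with `σ (a ⊗ r) = σ a ⊗ σ r`. -/
noncomputable instance : DifferenceRing (BaseChange k K R) where
  σ := RingEquiv.ofBijective (σTensorHom k K R) (σTensorHom_bijective k K R)

variable {K R} in
/-- The element `a ⊗ r` of `K ⊗_k R`. -/
def mk (a : K) (r : R) : BaseChange k K R := a ⊗ₜ[k] r

theorem σ_mk (a : K) (r : R) : σ (mk k a r) = mk k (σ a) (σ r) := rfl

theorem algebraMap_eq (a : K) : algebraMap K (BaseChange k K R) a = mk k a 1 :=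
  Algebra.TensorProduct.algebraMap_apply a

instance : Extension K (BaseChange k K R) where
  σ_algebraMap a := by rw [algebraMap_eq, algebraMap_eq, σ_mk, map_one]

end BaseChange

end BaseChange

/-! ### Extension of the constants and the Galois group -/

section Galois

variable (K R : Type u) [Field K] [DifferenceRing K] [CommRing R] [DifferenceRing R] [Algebra K R]
  [Extension K R]

/-- The automorphism of `R`, as an automorphism over the constants of `K`. -/
def σConst : R ≃ₐ[constants K] R :=
  AlgEquiv.ofRingEquiv (f := (σ : R ≃+* R)) fun c => by
    change σ (algebraMap K R c) = algebraMap K R c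
    rw [Extension.σ_algebraMap, mem_constants.1 c.2]

/-- The automorphism `r ⊗ b ↦ σ r ⊗ b` of `R ⊗_C B`, where `C` is the field of constants of `K`
and `B` is a `C`-algebra. -/
noncomputable def σExt (B : Type u) [CommRing B] [Algebra (constants K) B] :
    (R ⊗[constants K] B) ≃+* (R ⊗[constants K] B) :=
  (Algebra.TensorProduct.congr (σConst K R) (AlgEquiv.refl : B ≃ₐ[constants K] B)).toRingEquiv

theorem σExt_tmul (B : Type u) [CommRing B] [Algebra (constants K) B] (r : R) (b : B) :
    σExt K R B (r ⊗ₜ b) = (σ r) ⊗ₜ b := rfl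

/-- The group of `B`-points of the Galois group of `R` over `K`: the automorphisms of `R ⊗_C B`
which are linear over `K ⊗_C B` (that is, over `K` and over `B`) and commute with `σ`. -/
def galoisPoints (B : Type u) [CommRing B] [Algebra (constants K) B] :
    Subgroup ((R ⊗[constants K] B) ≃ₐ[K] (R ⊗[constants K] B)) where
  carrier := {φ | (∀ b : B, φ (1 ⊗ₜ b) = 1 ⊗ₜ b) ∧ ∀ x, φ (σExt K R B x) = σExt K R B (φ x)}
  one_mem' := ⟨fun _ => rfl, fun _ => rfl⟩
  mul_mem' := fun {φ ψ} hφ hψ =>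
    ⟨fun b => by rw [AlgEquiv.mul_apply, hψ.1, hφ.1],
      fun x => by rw [AlgEquiv.mul_apply, hψ.2, hφ.2, AlgEquiv.mul_apply]⟩
  inv_mem' := fun {φ} hφ =>
    ⟨fun b => (AlgEquiv.symm_apply_eq φ).2 (hφ.1 b).symm,
      fun x => (AlgEquiv.symm_apply_eq φ).2 (by
        rw [hφ.2]
        exact congrArg _ (AlgEquiv.apply_symm_apply φ x).symm)⟩

section Functoriality

variable {K R} {B B' B'' : Type u} [CommRing B] [Algebra (constants K) B]
  [CommRing B'] [Algebra (constants K) B'] [CommRing B''] [Algebra (constants K) B'']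

variable (R) in
/-- The map `id ⊗ f : R ⊗_C B → R ⊗_C B'`. -/
noncomputable def tensorMap (f : B →ₐ[constants K] B') :
    (R ⊗[constants K] B) →ₐ[K] (R ⊗[constants K] B') :=
  Algebra.TensorProduct.map (AlgHom.id K R) f

/-- The `B'`-linear extension of `φ` along `f : B → B'`. -/
noncomputable def extendHom (f : B →ₐ[constants K] B')
    (φ : (R ⊗[constants K] B) ≃ₐ[K] (R ⊗[constants K] B)) :
    (R ⊗[constants K] B') →ₐ[K] (R ⊗[constants K] B') :=
  Algebra.TensorProduct.lift
    ((tensorMap R f).comp (φ.toAlgHom.comp Algebra.TensorProduct.includeLeft))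
    Algebra.TensorProduct.includeRight fun _ _ => Commute.all _ _

theorem extendHom_tmul (f : B →ₐ[constants K] B')
    (φ : (R ⊗[constants K] B) ≃ₐ[K] (R ⊗[constants K] B)) (r : R) (b : B') :
    extendHom f φ (r ⊗ₜ b) = tensorMap R f (φ (r ⊗ₜ 1)) * (1 ⊗ₜ b) := by
  simp [extendHom]

theorem tmul_eq (r : R) (b : B) : (r ⊗ₜ[constants K] b) = (r ⊗ₜ 1) * (1 ⊗ₜ b) := by simp

theorem extendHom_tensorMap (f : B →ₐ[constants K] B') (φ : galoisPoints K R B)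
    (x : R ⊗[constants K] B) :
    extendHom f φ.1 (tensorMap R f x) = tensorMap R f (φ.1 x) := by
  induction x with
  | zero => simp
  | add x y hx hy => rw [map_add, map_add, hx, hy, map_add, map_add]
  | tmul r b =>
    have h : φ.1 (r ⊗ₜ b) = φ.1 (r ⊗ₜ 1) * (1 ⊗ₜ b) := by
      rw [tmul_eq, map_mul, φ.2.1]
    have h' : tensorMap R f (r ⊗ₜ b) = r ⊗ₜ f b := by simp [tensorMap]
    have h'' : tensorMap R f ((1 : R) ⊗ₜ b) = 1 ⊗ₜ f b := by simp [tensorMap]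
    rw [h, h', extendHom_tmul, map_mul, h'']

theorem extendHom_mul (f : B →ₐ[constants K] B') (φ ψ : galoisPoints K R B)
    (x : R ⊗[constants K] B') :
    extendHom f (φ * ψ).1 x = extendHom f φ.1 (extendHom f ψ.1 x) := by
  induction x with
  | zero => simp
  | add x y hx hy => rw [map_add, map_add, hx, hy, map_add]
  | tmul r b =>
    have h : extendHom f φ.1 ((1 : R) ⊗ₜ b) = 1 ⊗ₜ b := by
      rw [extendHom_tmul, ← Algebra.TensorProduct.one_def, map_one, map_one, one_mul]
    rw [extendHom_tmul, extendHom_tmul, map_mul, extendHom_tensorMap, h]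
    rfl

theorem extendHom_one (f : B →ₐ[constants K] B') (x : R ⊗[constants K] B') :
    extendHom f (1 : galoisPoints K R B).1 x = x := by
  induction x with
  | zero => simp
  | add x y hx hy => rw [map_add, hx, hy]
  | tmul r b =>
    rw [extendHom_tmul, tmul_eq]
    simp [tensorMap]

theorem tensorMap_σExt (f : B →ₐ[constants K] B') (x : R ⊗[constants K] B) :
    tensorMap R f (σExt K R B x) = σExt K R B' (tensorMap R f x) := by
  induction x with
  | zero => simp
  | add x y hx hy => rw [map_add, map_add, hx, hy, map_add, map_add]
  | tmul r b => simp [tensorMap, σExt_tmul]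

theorem extendHom_σExt (f : B →ₐ[constants K] B') (φ : galoisPoints K R B)
    (x : R ⊗[constants K] B') :
    extendHom f φ.1 (σExt K R B' x) = σExt K R B' (extendHom f φ.1 x) := by
  induction x with
  | zero => simp
  | add x y hx hy => rw [map_add, map_add, hx, hy, map_add, map_add]
  | tmul r b =>
    have h : φ.1 (σ r ⊗ₜ 1) = σExt K R B (φ.1 (r ⊗ₜ 1)) := by
      rw [← φ.2.2, σExt_tmul]
    rw [σExt_tmul, extendHom_tmul, extendHom_tmul, map_mul, h, tensorMap_σExt, σExt_tmul, map_one]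

/-- The group homomorphism from `B`-points to `B'`-points given by `B'`-linear extension. -/
noncomputable def galoisMap (f : B →ₐ[constants K] B') :
    galoisPoints K R B →* galoisPoints K R B' where
  toFun φ :=
    ⟨AlgEquiv.ofAlgHom (extendHom f φ.1) (extendHom f (φ⁻¹).1)
      (AlgHom.ext fun x => by
        change extendHom f φ.1 (extendHom f (φ⁻¹).1 x) = x
        rw [← extendHom_mul, mul_inv_cancel, extendHom_one])
      (AlgHom.ext fun x => by
        change extendHom f (φ⁻¹).1 (extendHom f φ.1 x) = x
        rw [← extendHom_mul, inv_mul_cancel, extendHom_one]),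
     ⟨fun b => by
        change extendHom f φ.1 ((1 : R) ⊗ₜ b) = 1 ⊗ₜ b
        rw [extendHom_tmul, ← Algebra.TensorProduct.one_def, map_one, map_one, one_mul],
      extendHom_σExt f φ⟩⟩
  map_one' := Subtype.ext (AlgEquiv.ext (extendHom_one f))
  map_mul' φ ψ := Subtype.ext (AlgEquiv.ext (extendHom_mul f φ ψ))

theorem galoisMap_id (φ : galoisPoints K R B) :
    galoisMap (AlgHom.id (constants K) B) φ = φ := by
  refine Subtype.ext (AlgEquiv.ext fun x => ?_)
  change extendHom _ φ.1 x = φ.1 x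
  have h := extendHom_tensorMap (AlgHom.id (constants K) B) φ x
  simpa [tensorMap] using h

theorem galoisMap_comp (g : B' →ₐ[constants K] B'') (f : B →ₐ[constants K] B')
    (φ : galoisPoints K R B) :
    galoisMap (g.comp f) φ = galoisMap g (galoisMap f φ) := by
  refine Subtype.ext (AlgEquiv.ext fun x => ?_)
  change extendHom (g.comp f) φ.1 x = extendHom g (galoisMap f φ).1 x
  have hc : ∀ y : R ⊗[constants K] B,
      tensorMap R (g.comp f) y = tensorMap R g (tensorMap R f y) := fun y => by
    induction y with
    | zero => simp
    | add x y hx hy => rw [map_add, map_add, map_add, hx, hy]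
    | tmul r b => simp [tensorMap]
  induction x with
  | zero => simp
  | add x y hx hy => rw [map_add, map_add, hx, hy]
  | tmul r b =>
    rw [extendHom_tmul, extendHom_tmul, hc]
    congr 2
    change _ = extendHom f φ.1 (r ⊗ₜ 1)
    rw [extendHom_tmul, ← Algebra.TensorProduct.one_def, mul_one]

end Functoriality

/-- The Galois group of `R` over `K`, as a functor from commutative algebras over the field `C` of
constants of `K` to groups: `B ↦ Aut^σ(R ⊗_C B / K ⊗_C B)`. -/
noncomputable def galoisGroup : CommAlgCat.{u} (constants K) ⥤ GrpCat.{u} where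
  obj B := GrpCat.of (galoisPoints K R B)
  map f := GrpCat.ofHom (galoisMap f.hom)
  map_id _ := GrpCat.hom_ext (MonoidHom.ext galoisMap_id)
  map_comp f g := GrpCat.hom_ext (MonoidHom.ext (galoisMap_comp g.hom f.hom))

end Galois

/-- A group functor over `C` is a linear algebraic group (an affine group scheme of finite type)
if it is represented by a finitely generated `C`-algebra. -/
def IsLinearAlgebraicGroup {C : Type u} [Field C] (G : CommAlgCat.{u} C ⥤ GrpCat.{u}) : Prop :=
  ∃ U : CommAlgCat.{u} C, Algebra.FiniteType C U ∧
    Nonempty ((G ⋙ forget GrpCat.{u}).CorepresentableBy U)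

/-- Restriction of scalars of commutative algebras from `F` to `C`. -/
def restrictAlg (C F : Type u) [Field C] [Field F] [Algebra C F] :
    CommAlgCat.{u} F ⥤ CommAlgCat.{u} C where
  obj B :=
    letI : Algebra C B := Algebra.compHom B (algebraMap C F)
    CommAlgCat.of C B
  map {B B'} f :=
    letI : Algebra C B := Algebra.compHom B (algebraMap C F)
    letI : Algebra C B' := Algebra.compHom B' (algebraMap C F)
    CommAlgCat.ofHom
      ({ f.hom.toRingHom with commutes' := fun c => f.hom.commutes (algebraMap C F c) } :
        B →ₐ[C] B')

/-- The base change to `F` of a group functor over `C`: its `B`-points, for an `F`-algebra `B`,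
are the points of the given functor in `B` viewed as a `C`-algebra. -/
def groupBaseChange {C : Type u} [Field C] (F : Type u) [Field F] [Algebra C F]
    (G : CommAlgCat.{u} C ⥤ GrpCat.{u}) : CommAlgCat.{u} F ⥤ GrpCat.{u} :=
  restrictAlg C F ⋙ G

end DifferenceRing

open DifferenceRing

/-
Write `S = K ⊗_k R`, and let `Z` and `V` be the fundamental matrices of `R` and of `L`. The ring
`R` has no new constants because `C` is algebraically closed. Since `K` is generated by constants
over `k`, every element of `S` is a quotient of an element of `R ⊗_C C_K` by one of `K`, and
simplicity and the absence of new constants pass from `R` to `S`.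

The matrix `V⁻¹ Z` over `L ⊗_K S` is invariant under `σ`. If `D` is the `C_K`-algebra generated by
its entries and the inverse of its determinant, then `L ⊗_K S = L ⊗_{C_K} D`, so that the points of
`D` in a `C_K`-algebra `B` are the equivariant homomorphisms `S → L ⊗_{C_K} B`. By the
Nullstellensatz there is a point in an algebraic closure `F` of `C_K`. It sends `Z` to `V P` for a
matrix `P` over `F`, so it takes values in `T ⊗ F`, and its `F`-linear extension
`Φ : S ⊗ F → T ⊗ F` is surjective; it is injective because `S` is simple, and simplicity descends
along it from `S` to `T`.

For `L = S = R` the algebra `D` represents the Galois group. The groups of `R` and of `T` are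
compared over an `F`-algebra `B` by `θ ∘ ι = ι ∘ φ`, where `ι : R ⊗_C B → T ⊗_{C_K} B` is induced
by `Φ`: any such `φ` and `θ` determine each other, because each sends a fundamental matrix to its
product with a matrix over `B`.
-/

namespace DifferenceRing

section ConstantExtension

variable {K M B : Type u} [Field K] [DifferenceRing K] [CommRing M] [DifferenceRing M]
  [Algebra K M] [Extension K M] [CommRing B] [Algebra (constants K) B]

theorem σExt_one_tmul (b : B) : σExt K M B (1 ⊗ₜ b) = 1 ⊗ₜ b := by
  rw [σExt_tmul, map_one]

theorem basis_repr_σExt {ι : Type*} (b : Module.Basis ι (constants K) B)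
    (x : M ⊗[constants K] B) (i : ι) :
    (Algebra.TensorProduct.basis M b).repr (σExt K M B x) i =
      σ ((Algebra.TensorProduct.basis M b).repr x i) := by
  induction x with
  | zero => simp
  | add x y hx hy => simp only [map_add, Finsupp.add_apply, hx, hy]
  | tmul m c =>
    rw [σExt_tmul, Algebra.TensorProduct.basis_repr_tmul, Algebra.TensorProduct.basis_repr_tmul]
    simp only [Finsupp.smul_apply, Finsupp.mapRange_apply, smul_eq_mul, map_mul]
    exact congrArg _ ((σConst K M).commutes _).symm

theorem NoNewConstants.exists_one_tmul_eq (hc : NoNewConstants K M) {x : M ⊗[constants K] B}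
    (hx : σExt K M B x = x) : ∃ b : B, 1 ⊗ₜ b = x := by
  let e := Algebra.TensorProduct.basis M (Module.Free.chooseBasis (constants K) B)
  have hmem : Finsupp.linearCombination M e (e.repr x) ∈ (Algebra.TensorProduct.includeRight :
      B →ₐ[constants K] M ⊗[constants K] B).range := by
    refine Subalgebra.sum_mem _ fun i _ => ?_
    obtain ⟨c, hc, h⟩ := hc (e.repr x i) (by rw [← basis_repr_σExt, hx])
    refine ⟨(⟨c, hc⟩ : constants K) • Module.Free.chooseBasis (constants K) B i, ?_⟩
    calc (1 : M) ⊗ₜ[constants K] ((⟨c, hc⟩ : constants K) • Module.Free.chooseBasis _ B i)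
        = (⟨c, hc⟩ : constants K) • e i := by
          rw [TensorProduct.tmul_smul, Algebra.TensorProduct.basis_apply]; rfl
      _ = e.repr x i • e i := by rw [← h, algebraMap_smul]; rfl
  rwa [e.linearCombination_repr] at hmem

theorem IsSimple.exists_mem_repr_eq_one (hs : IsSimple M) {J : Ideal (M ⊗[constants K] B)}
    (hJ : ∀ x ∈ J, σExt K M B x ∈ J) {ι : Type*} (b : Module.Basis ι (constants K) B)
    {x : M ⊗[constants K] B} (hx : x ∈ J) {i : ι}
    (hi : (Algebra.TensorProduct.basis M b).repr x i ≠ 0) :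
    ∃ y ∈ J, (Algebra.TensorProduct.basis M b).repr y i = 1 ∧
      ((Algebra.TensorProduct.basis M b).repr y).support ⊆
        ((Algebra.TensorProduct.basis M b).repr x).support := by
  let e := Algebra.TensorProduct.basis M b
  let I : Ideal M := ((J.restrictScalars M) ⊓
    (Finsupp.supported M M ↑(e.repr x).support).comap e.repr.toLinearMap).map (e.coord i)
  have hI : ∀ r ∈ I, σ r ∈ I := by
    rintro _ ⟨y, ⟨hy, hys⟩, rfl⟩
    refine ⟨σExt K M B y, ⟨hJ y hy, fun j hj => hys ?_⟩, basis_repr_σExt b y i⟩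
    contrapose! hj
    rw [Finset.mem_coe, Finsupp.notMem_support_iff] at hj ⊢
    exact (basis_repr_σExt b y j).trans ((congrArg σ hj).trans (map_zero σ))
  have htop : I = ⊤ := (hs.2 I hI).resolve_left fun h => hi <| by
    have : e.coord i x ∈ I := ⟨x, ⟨hx, (Finsupp.mem_supported M _).2 subset_rfl⟩, rfl⟩
    rwa [h] at this
  obtain ⟨y, ⟨hy, hys⟩, hyi⟩ : (1 : M) ∈ I := htop ▸ Submodule.mem_top
  exact ⟨y, hy, hyi, Finset.coe_subset.1 hys⟩

/- An element of the ideal with one coordinate equal to `1` is fixed by `σ` as soon as the elements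
with smaller support vanish. -/
theorem IsSimple.eq_bot_of_invariant (hs : IsSimple M) (hc : NoNewConstants K M)
    {J : Ideal (M ⊗[constants K] B)} (hJ : ∀ x ∈ J, σExt K M B x ∈ J)
    (hB : ∀ b : B, (1 : M) ⊗ₜ[constants K] b ∈ J → b = 0) : J = ⊥ := by
  classical
  let b := Module.Free.chooseBasis (constants K) B
  let e := Algebra.TensorProduct.basis M b
  suffices h : ∀ s : Finset _, ∀ x ∈ J, (e.repr x).support ⊆ s → x = 0 from
    (Submodule.eq_bot_iff J).2 fun x hx => h _ x hx subset_rfl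
  intro s
  induction s using Finset.induction_on with
  | empty =>
    intro x _ hx
    rwa [Finset.subset_empty, Finsupp.support_eq_empty, e.repr.map_eq_zero_iff] at hx
  | insert i s _ ih =>
    intro x hx hxs
    by_cases hi : e.repr x i = 0
    · exact ih x hx ((Finset.subset_insert_iff_of_notMem (Finsupp.notMem_support_iff.2 hi)).1 hxs)
    obtain ⟨y, hy, hyi, hyx⟩ := hs.exists_mem_repr_eq_one hJ b hx hi
    have hfix : σExt K M B y - y = 0 := by
      refine ih _ (J.sub_mem (hJ y hy) hy) fun j hj => ?_
      have hsub : e.repr (σExt K M B y - y) j = σ (e.repr y j) - e.repr y j := by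
        rw [map_sub, Finsupp.sub_apply, basis_repr_σExt]
      rw [Finsupp.mem_support_iff, hsub] at hj
      refine Finset.mem_of_mem_insert_of_ne (hxs (hyx ?_)) ?_
      · exact Finsupp.mem_support_iff.2 fun h => hj (by rw [h, map_zero, sub_zero])
      · rintro rfl
        exact hj (by rw [hyi, map_one, sub_self])
    obtain ⟨c, rfl⟩ := hc.exists_one_tmul_eq (sub_eq_zero.1 hfix)
    have := hs.1
    rw [hB c hy, TensorProduct.tmul_zero, map_zero, Finsupp.zero_apply] at hyi
    exact absurd hyi zero_ne_one

theorem IsSimple.eq_bot_or_eq_top_of_invariant {F : Type u} [Field F] [Algebra (constants K) F]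
    (hs : IsSimple M) (hc : NoNewConstants K M) {J : Ideal (M ⊗[constants K] F)}
    (hJ : ∀ x ∈ J, σExt K M F x ∈ J) : J = ⊥ ∨ J = ⊤ := by
  refine or_iff_not_imp_right.2 fun htop => hs.eq_bot_of_invariant hc hJ fun b hb => ?_
  by_contra hb0
  exact htop (J.eq_top_of_isUnit_mem hb ((IsUnit.mk0 b hb0).map
    (Algebra.TensorProduct.includeRight : F →ₐ[constants K] M ⊗[constants K] F)))

end ConstantExtension

section TensorLift

variable {K M B N : Type u} [Field K] [DifferenceRing K] [CommRing M] [Algebra K M] [CommRing B]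
  [Algebra (constants K) B] [CommRing N] [Algebra K N]

/-- The homomorphism `m ⊗ b ↦ f m * g b` out of `M ⊗_C B`, where `C` is the field of constants
of `K`. -/
noncomputable def tensorLift (f : M →ₐ[K] N) (g : B →ₐ[constants K] N) :
    M ⊗[constants K] B →ₐ[K] N :=
  Algebra.TensorProduct.lift f g fun _ _ => Commute.all _ _

theorem tensorLift_tmul (f : M →ₐ[K] N) (g : B →ₐ[constants K] N) (m : M) (b : B) :
    tensorLift f g (m ⊗ₜ b) = f m * g b := rfl

theorem tensorLift_tmul_one (f : M →ₐ[K] N) (g : B →ₐ[constants K] N) (m : M) :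
    tensorLift f g (m ⊗ₜ 1) = f m := by
  rw [tensorLift_tmul, map_one, mul_one]

theorem tensorLift_one_tmul (f : M →ₐ[K] N) (g : B →ₐ[constants K] N) (b : B) :
    tensorLift f g (1 ⊗ₜ b) = g b := by
  rw [tensorLift_tmul, map_one, one_mul]

theorem algHom_tensor_ext {φ ψ : M ⊗[constants K] B →ₐ[K] N}
    (hM : ∀ m : M, φ (m ⊗ₜ 1) = ψ (m ⊗ₜ 1)) (hB : ∀ b : B, φ (1 ⊗ₜ b) = ψ (1 ⊗ₜ b)) : φ = ψ :=
  Algebra.TensorProduct.ext (AlgHom.ext hM) (AlgHom.ext hB)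

variable [DifferenceRing M] [Extension K M]

theorem tensorLift_σExt {f : M →ₐ[K] N} {g : B →ₐ[constants K] N} {τ : N →+* N}
    (hf : ∀ m, f (σ m) = τ (f m)) (hg : ∀ b, τ (g b) = g b) (x : M ⊗[constants K] B) :
    tensorLift f g (σExt K M B x) = τ (tensorLift f g x) := by
  induction x with
  | zero => simp
  | add x y hx hy => simp only [map_add, hx, hy]
  | tmul m b => rw [σExt_tmul, tensorLift_tmul, tensorLift_tmul, map_mul, hf, hg]

theorem IsSimple.tensorLift_injective (hs : IsSimple M) (hc : NoNewConstants K M)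
    {f : M →ₐ[K] N} {g : B →ₐ[constants K] N} {τ : N →+* N}
    (hf : ∀ m, f (σ m) = τ (f m)) (hg : ∀ b, τ (g b) = g b) (hinj : Function.Injective g) :
    Function.Injective (tensorLift f g) := by
  rw [← AlgHom.coe_toRingHom, RingHom.injective_iff_ker_eq_bot]
  refine hs.eq_bot_of_invariant hc (fun x hx => ?_) fun b hb => ?_
  · rw [RingHom.mem_ker, AlgHom.coe_toRingHom] at hx ⊢
    rw [tensorLift_σExt hf hg, hx, map_zero]
  · rw [RingHom.mem_ker, AlgHom.coe_toRingHom, tensorLift_one_tmul] at hb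
    exact (map_eq_zero_iff g hinj).1 hb

end TensorLift

theorem isSimple_of_field (L : Type*) [Field L] [DifferenceRing L] : IsSimple L :=
  ⟨inferInstance, fun I _ => Ideal.eq_bot_or_top I⟩

section Generation

open Matrix

theorem glMap_injective {N N' ι : Type*} [CommRing N] [CommRing N'] [Fintype ι] [DecidableEq ι]
    {φ : N →+* N'} (hφ : Function.Injective φ) :
    Function.Injective (GeneralLinearGroup.map (n := ι) φ) :=
  fun _ _ h => Units.ext (Matrix.map_injective hφ (congrArg Units.val h))

variable {C N N' ι : Type*} [CommRing C] [CommRing N] [Algebra C N] [CommRing N'] [Fintype ι]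
  [DecidableEq ι]

variable (C) in
/-- The subring `C[W, 1/det W]` generated by an invertible matrix. -/
def adjoinGL (W : GL ι N) : Subalgebra C N :=
  Algebra.adjoin C (Set.range (fun p : ι × ι => W p.1 p.2) ∪
    {((GeneralLinearGroup.det W)⁻¹ : Nˣ).1})

theorem entry_mem_adjoinGL (W : GL ι N) (i j : ι) : W i j ∈ adjoinGL C W :=
  Algebra.subset_adjoin (Or.inl ⟨(i, j), rfl⟩)

theorem det_inv_mem_adjoinGL (W : GL ι N) :
    ((GeneralLinearGroup.det W)⁻¹ : Nˣ).1 ∈ adjoinGL C W :=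
  Algebra.subset_adjoin (Or.inr rfl)

theorem adjoinGL_fg (W : GL ι N) : (adjoinGL C W).FG :=
  Subalgebra.fg_def.2 ⟨_, (Set.finite_range _).union (Set.finite_singleton _), rfl⟩

theorem eqOn_adjoinGL {φ ψ : N →+* N'} (hC : ∀ c, φ (algebraMap C N c) = ψ (algebraMap C N c))
    {W : GL ι N} (hW : GeneralLinearGroup.map φ W = GeneralLinearGroup.map ψ W) :
    Set.EqOn φ ψ (adjoinGL C W) := by
  have hdet := congrArg (fun W => ((GeneralLinearGroup.det W)⁻¹).1) hW
  simp only [GeneralLinearGroup.map_det, ← map_inv] at hdet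
  intro x hx
  induction hx using Algebra.adjoin_induction with
  | mem x hx =>
    rcases hx with ⟨p, rfl⟩ | rfl
    · exact congrArg (fun W : GL ι N' => W p.1 p.2) hW
    · exact hdet
  | algebraMap c => exact hC c
  | add x y _ _ hx hy => rw [map_add, map_add, hx, hy]
  | mul x y _ _ hx hy => rw [map_mul, map_mul, hx, hy]

variable [Algebra C N']

theorem map_adjoinGL (φ : N →ₐ[C] N') (W : GL ι N) :
    (adjoinGL C W).map φ = adjoinGL C (GeneralLinearGroup.map (φ : N →+* N') W) := by
  rw [adjoinGL, AlgHom.map_adjoin, Set.image_union, ← Set.range_comp, Set.image_singleton,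
    adjoinGL, GeneralLinearGroup.map_det, ← map_inv]
  rfl

theorem adjoinGL_le_range_iff {φ : N →ₐ[C] N'} (hφ : Function.Injective φ) {W : GL ι N'} :
    adjoinGL C W ≤ φ.range ↔ W ∈ (GeneralLinearGroup.map (n := ι) (φ : N →+* N')).range := by
  constructor
  · intro h
    choose W₀ hW₀ using fun i j => h (entry_mem_adjoinGL W i j)
    obtain ⟨d, hd⟩ := h (det_inv_mem_adjoinGL W)
    have hmap : (φ : N →+* N').mapMatrix (Matrix.of W₀) = W.1 := Matrix.ext hW₀
    have hdet : (Matrix.of W₀).det * d = 1 := hφ <| by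
      have h₁ : φ (Matrix.of W₀).det = (GeneralLinearGroup.det W).1 :=
        ((φ : N →+* N').map_det _).trans (congrArg Matrix.det hmap)
      have h₂ : φ d = ((GeneralLinearGroup.det W)⁻¹ : N'ˣ).1 := hd
      rw [map_mul, map_one, h₁, h₂, Units.mul_inv]
    exact ⟨GeneralLinearGroup.mk'' (Matrix.of W₀) (IsUnit.of_mul_eq_one _ hdet), Units.ext hmap⟩
  · rintro ⟨W₀, rfl⟩
    rw [← map_adjoinGL]
    rintro _ ⟨x, -, rfl⟩
    exact ⟨x, rfl⟩

theorem map_mem_range_map_val {Y : Type*} [CommRing Y] {X : Subalgebra C N} {f : Y →+* N}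
    (hf : ∀ y, f y ∈ X) (W : GL ι Y) :
    GeneralLinearGroup.map f W ∈ (GeneralLinearGroup.map (n := ι) (X.val : X →+* N)).range :=
  ⟨GeneralLinearGroup.map (f.codRestrict X hf) W, rfl⟩

theorem exists_comp_eq_of_range_le {S : Type*} [CommRing S] [Algebra C S] {f : N →ₐ[C] N'}
    (hf : Function.Injective f) {g : S →ₐ[C] N'} (h : g.range ≤ f.range) :
    ∃ g' : S →ₐ[C] N, f.comp g' = g := by
  refine ⟨((AlgEquiv.ofInjective f hf).symm : f.range →ₐ[C] N).comp
    (g.codRestrict f.range fun s => h ⟨s, rfl⟩), AlgHom.ext fun s => ?_⟩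
  exact congrArg Subtype.val ((AlgEquiv.ofInjective f hf).apply_symm_apply ⟨g s, h ⟨s, rfl⟩⟩)

end Generation

section Fundamental

open Matrix

variable {K S M N : Type*} [Field K] {n : ℕ} {A : GL (Fin n) K} [CommRing S] [DifferenceRing S]
  [Algebra K S] [CommRing M] [DifferenceRing M] [Algebra K M] [CommRing N] [Algebra K N]

namespace FundamentalMatrix

theorem ring_eq_adjoinGL (Z : FundamentalMatrix A S) : Z.ring = adjoinGL K Z.mat := rfl

theorem range_eq_adjoinGL {Z : FundamentalMatrix A S} (hZ : Z.ring = ⊤) (ρ : S →ₐ[K] N) :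
    ρ.range = adjoinGL K (GeneralLinearGroup.map (ρ : S →+* N) Z.mat) := by
  rw [← map_adjoinGL, ← Z.ring_eq_adjoinGL, hZ, Algebra.map_top]

theorem range_le {Z : FundamentalMatrix A S} (hZ : Z.ring = ⊤) {ρ : S →ₐ[K] N}
    {X : Subalgebra K N} (h : GeneralLinearGroup.map (ρ : S →+* N) Z.mat ∈
      (GeneralLinearGroup.map (n := Fin n) (X.val : X →+* N)).range) : ρ.range ≤ X := by
  rw [range_eq_adjoinGL hZ, ← X.range_val]
  exact (adjoinGL_le_range_iff Subtype.val_injective).2 h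

theorem finiteType {Z : FundamentalMatrix A S} (hZ : Z.ring = ⊤) : Algebra.FiniteType K S :=
  ⟨hZ ▸ adjoinGL_fg Z.mat⟩

theorem map_map_of_equivariant (Z : FundamentalMatrix A S) {τ : N →+* N} {ρ : S →ₐ[K] N}
    (hρ : ∀ s, ρ (σ s) = τ (ρ s)) :
    GeneralLinearGroup.map τ (GeneralLinearGroup.map (ρ : S →+* N) Z.mat) =
      GeneralLinearGroup.map (algebraMap K N) A * GeneralLinearGroup.map (ρ : S →+* N) Z.mat := by
  have h := congrArg (GeneralLinearGroup.map (ρ : S →+* N)) Z.map_σ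
  rw [map_mul, ← MonoidHom.comp_apply, ← MonoidHom.comp_apply, ← GeneralLinearGroup.map_comp,
    ← GeneralLinearGroup.map_comp, AlgHom.comp_algebraMap] at h
  rw [← h]
  exact GeneralLinearGroup.ext fun i j => (hρ _).symm

theorem map_inv_mul_eq_self (V : FundamentalMatrix A M) (Z : FundamentalMatrix A S) {τ : N →+* N}
    {f : M →ₐ[K] N} (hf : ∀ m, f (σ m) = τ (f m)) {ρ : S →ₐ[K] N} (hρ : ∀ s, ρ (σ s) = τ (ρ s)) :
    GeneralLinearGroup.map τ ((GeneralLinearGroup.map (f : M →+* N) V.mat)⁻¹ *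
      GeneralLinearGroup.map (ρ : S →+* N) Z.mat) =
    (GeneralLinearGroup.map (f : M →+* N) V.mat)⁻¹ *
      GeneralLinearGroup.map (ρ : S →+* N) Z.mat := by
  rw [map_mul, map_inv, V.map_map_of_equivariant hf, Z.map_map_of_equivariant hρ]
  group

theorem exists_ring_eq_top [DifferenceRing K] [Extension K S] (V : FundamentalMatrix A S) :
    ∃ W : FundamentalMatrix A V.ring, W.ring = ⊤ := by
  have hinj : Function.Injective V.ring.val := Subtype.val_injective
  obtain ⟨W, hW⟩ := (adjoinGL_le_range_iff hinj (W := V.mat)).1 <| by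
    rw [Subalgebra.range_val, V.ring_eq_adjoinGL]
  have hσ : GeneralLinearGroup.map ((σ : V.ring ≃+* V.ring) : V.ring →+* V.ring) W =
      GeneralLinearGroup.map (algebraMap K V.ring) A * W := by
    have h := V.map_σ
    rw [← hW] at h
    refine glMap_injective (φ := (V.ring.val : V.ring →+* S)) hinj ?_
    rw [map_mul]
    exact h
  refine ⟨⟨W, hσ⟩, Subalgebra.map_injective (f := V.ring.val) hinj ?_⟩
  calc (adjoinGL K W).map V.ring.val = V.ring := by rw [map_adjoinGL, hW, ring_eq_adjoinGL]
    _ = (⊤ : Subalgebra K V.ring).map V.ring.val := by rw [Algebra.map_top, Subalgebra.range_val]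

end FundamentalMatrix

end Fundamental

section Constants

open Polynomial

variable {K R : Type*} [Field K] [CommRing R] [Algebra K R]

/- The image of `Spec R` in the affine line is open by going down. -/
theorem finite_resolventSet [Nontrivial R] [Algebra.FiniteType K R] {c : R}
    (htf : ∀ p : K[X], p ≠ 0 → ∀ r, aeval c p * r = 0 → r = 0) : (resolventSet K c).Finite := by
  let _ : Algebra K[X] R := (aeval (R := K) c).toAlgebra
  have hmap (p : K[X]) : algebraMap K[X] R p = aeval c p := rfl
  have : IsScalarTower K K[X] R := IsScalarTower.of_algebraMap_eq fun a => by
    rw [hmap, ← C_eq_algebraMap, aeval_C]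
  have : Algebra.FiniteType K[X] R := Algebra.FiniteType.of_restrictScalars_finiteType K _ _
  have : Algebra.FinitePresentation K[X] R := Algebra.FinitePresentation.of_finiteType.1 this
  have : Module.IsTorsionFree K[X] R := ⟨fun p hp r s hrs => sub_eq_zero.1 <|
    htf p hp.ne_zero _ (by rw [mul_sub, sub_eq_zero]; exact hrs)⟩
  have hopen : IsOpen (Set.range (PrimeSpectrum.comap (algebraMap K[X] R))) :=
    PrimeSpectrum.isOpenMap_comap_of_hasGoingDown_of_finitePresentation.isOpen_range
  obtain ⟨q⟩ := (inferInstance : Nonempty (PrimeSpectrum R))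
  obtain ⟨_, ⟨_, ⟨g, rfl⟩, rfl⟩, hg, hgU⟩ :=
    PrimeSpectrum.isBasis_basic_opens.exists_subset_of_mem_open (Set.mem_range_self q) hopen
  have hg0 : g ≠ 0 := by
    rintro rfl
    exact hg (Submodule.zero_mem _)
  refine (rootSet_finite g K).subset fun d hd => ?_
  rw [mem_rootSet_of_ne hg0, coe_aeval_eq_eval]
  by_contra hroot
  let P : PrimeSpectrum K[X] := ⟨Ideal.span {X - C d},
    (Ideal.span_singleton_prime (X_sub_C_ne_zero _)).2 (prime_X_sub_C _)⟩
  obtain ⟨Q, hQ⟩ := hgU (show P ∈ PrimeSpectrum.basicOpen g from fun h =>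
    hroot (dvd_iff_isRoot.1 (Ideal.mem_span_singleton.1 h)))
  have hmem : C d - X ∈ (PrimeSpectrum.comap (algebraMap K[X] R) Q).asIdeal := by
    rw [hQ, ← neg_sub]
    exact neg_mem (Ideal.mem_span_singleton_self _)
  rw [PrimeSpectrum.comap_asIdeal, Ideal.mem_comap, hmap, map_sub, aeval_X, aeval_C] at hmem
  exact Q.2.ne_top (Ideal.eq_top_of_isUnit_mem _ hmem hd)

variable [DifferenceRing K] [DifferenceRing R]

theorem IsSimple.isUnit_of_σ_eq (hs : IsSimple R) {x : R} (hx : σ x = x) (h0 : x ≠ 0) :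
    IsUnit x := by
  refine Ideal.span_singleton_eq_top.1 ((hs.2 (Ideal.span {x}) fun y hy => ?_).resolve_left
    fun h => h0 (Ideal.span_singleton_eq_bot.1 h))
  obtain ⟨a, rfl⟩ := Ideal.mem_span_singleton'.1 hy
  rw [map_mul, hx]
  exact Ideal.mul_mem_left _ _ (Ideal.mem_span_singleton_self x)

variable [Extension K R]

theorem IsSimple.algebraMap_eq_of_mem_spectrum (hs : IsSimple R) {c : R} (hc : σ c = c)
    {d : constants K} (hd : d ∈ spectrum (constants K) c) : algebraMap K R d = c := by
  by_contra hne
  refine hd (hs.isUnit_of_σ_eq ?_ (sub_ne_zero.2 hne))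
  have h : algebraMap (constants K) R d = algebraMap K R d := rfl
  rw [map_sub, hc, h, Extension.σ_algebraMap, mem_constants.1 d.2]

theorem σ_aeval {c : R} (hc : σ c = c) (p : K[X]) :
    σ (aeval c p) = aeval c (p.map ((σ : K ≃+* K) : K →+* K)) := by
  induction p using Polynomial.induction_on' with
  | add p q hp hq => simp only [map_add, Polynomial.map_add, hp, hq]
  | monomial m a => simp [aeval_monomial, hc, Extension.σ_algebraMap]

theorem exists_map_eq_minpoly {c : R} (hc : σ c = c) (hint : IsIntegral K c) :
    ∃ q : (constants K)[X], q.map (algebraMap (constants K) K) = minpoly K c := by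
  have hmap : (minpoly K c).map ((σ : K ≃+* K) : K →+* K) = minpoly K c := by
    refine minpoly.unique K c ((minpoly.monic hint).map _) ?_ fun q hq hq0 => ?_
    · rw [← σ_aeval hc, minpoly.aeval, map_zero]
    · rw [degree_map]
      exact minpoly.min K c hq hq0
  refine (lifts_iff_coeff_lifts _).2 fun i => ⟨⟨(minpoly K c).coeff i, ?_⟩, rfl⟩
  rw [mem_constants]
  conv_rhs => rw [← hmap]
  rw [coeff_map]
  rfl

theorem spectrum_nonempty_of_isAlgebraic [IsAlgClosed (constants K)] [Nontrivial R] {c : R}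
    (hc : σ c = c) (halg : IsAlgebraic K c) : (spectrum (constants K) c).Nonempty := by
  obtain ⟨q, hq⟩ := exists_map_eq_minpoly hc halg.isIntegral
  have h0 : aeval c q = 0 := by rw [← aeval_map_algebraMap K, hq, minpoly.aeval]
  have hdeg : 0 < q.degree := by
    rw [← degree_map q (algebraMap (constants K) K), hq]
    exact minpoly.degree_pos halg.isIntegral
  have hspec := spectrum.map_polynomial_aeval_of_degree_pos c q hdeg
  rw [h0, spectrum.zero_eq] at hspec
  exact Set.image_nonempty.1 (hspec ▸ Set.singleton_nonempty 0)

theorem IsSimple.eq_zero_of_aeval_mul_eq_zero (hs : IsSimple R) {c : R} (hc : σ c = c)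
    (htr : Transcendental K c) {p : K[X]} (hp : p ≠ 0) {r : R} (hr : aeval c p * r = 0) :
    r = 0 := by
  let I : Ideal R := RingHom.ker
    (algebraMap R (Localization ((nonZeroDivisors K[X]).map (aeval c : K[X] →ₐ[K] R))))
  have hI (x : R) : x ∈ I ↔ ∃ p : K[X], p ≠ 0 ∧ aeval c p * x = 0 := by
    simp [I, RingHom.mem_ker, IsLocalization.map_eq_zero_iff
      ((nonZeroDivisors K[X]).map (aeval c : K[X] →ₐ[K] R))]
  have hbot : I = ⊥ := by
    refine (hs.2 I fun x hx => ?_).resolve_right fun htop => ?_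
    · obtain ⟨q, hq, h⟩ := (hI x).1 hx
      refine (hI _).2 ⟨q.map ((σ : K ≃+* K) : K →+* K),
        (Polynomial.map_ne_zero_iff (σ : K ≃+* K).injective).2 hq, ?_⟩
      rw [← σ_aeval hc, ← map_mul, h, map_zero]
    · obtain ⟨q, hq, h⟩ := (hI 1).1 (htop ▸ Submodule.mem_top)
      exact hq (transcendental_iff.1 htr q (by rwa [mul_one] at h))
  exact (Submodule.eq_bot_iff I).1 hbot r ((hI r).2 ⟨p, hp, hr⟩)

theorem IsSimple.noNewConstants [IsAlgClosed (constants K)] [Algebra.FiniteType K R]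
    (hs : IsSimple R) : NoNewConstants K R := by
  intro c hc
  have := hs.1
  suffices h : (spectrum (constants K) c).Nonempty by
    obtain ⟨d, hd⟩ := h
    exact ⟨d, d.2, hs.algebraMap_eq_of_mem_spectrum hc hd⟩
  by_cases halg : IsAlgebraic K c
  · exact spectrum_nonempty_of_isAlgebraic hc halg
  · have hfin := finite_resolventSet fun p hp r => hs.eq_zero_of_aeval_mul_eq_zero hc halg hp
    have := IsAlgClosed.instInfinite (K := constants K)
    obtain ⟨d, hd⟩ := (hfin.preimage (Subtype.val_injective (p := (· ∈ constants K))).injOn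
      ).infinite_compl.nonempty
    exact ⟨d, hd⟩

end Constants

theorem nonempty_algHom_of_isAlgClosed {C F D : Type*} [Field C] [Field F] [Algebra C F]
    [IsAlgClosed F] [CommRing D] [Algebra C D] [Nontrivial D] [Algebra.FiniteType C D] :
    Nonempty (D →ₐ[C] F) := by
  obtain ⟨m, hm⟩ := Ideal.exists_maximal D
  let _ := Ideal.Quotient.field m
  have : Module.Finite C (D ⧸ m) := finite_of_finite_type_of_isJacobsonRing C (D ⧸ m)
  exact ⟨(IsAlgClosed.lift : (D ⧸ m) →ₐ[C] F).comp (Ideal.Quotient.mkₐ C m)⟩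

section Comparison

open Matrix

variable {K S M B : Type u} [Field K] [DifferenceRing K] [CommRing S] [Algebra K S] [CommRing M]
  [Algebra K M] [CommRing B] [Algebra (constants K) B]

variable (K M B) in
theorem includeRight_injective [Nontrivial M] : Function.Injective
    (Algebra.TensorProduct.includeRight : B →ₐ[constants K] M ⊗[constants K] B) :=
  Algebra.TensorProduct.includeRight_injective (algebraMap (constants K) M).injective

/-- The `B`-linear extension `S ⊗_C B → M ⊗_C B` of `ρ`, where `C` is the field of constants
of `K`. -/
noncomputable def tensorExtend (ρ : S →ₐ[K] M ⊗[constants K] B) :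
    S ⊗[constants K] B →ₐ[K] M ⊗[constants K] B :=
  tensorLift ρ Algebra.TensorProduct.includeRight

theorem tensorExtend_tmul_one (ρ : S →ₐ[K] M ⊗[constants K] B) (s : S) :
    tensorExtend ρ (s ⊗ₜ 1) = ρ s :=
  tensorLift_tmul_one ..

theorem tensorExtend_one_tmul (ρ : S →ₐ[K] M ⊗[constants K] B) (b : B) :
    tensorExtend ρ (1 ⊗ₜ b) = 1 ⊗ₜ b :=
  tensorLift_one_tmul ..

variable [DifferenceRing S] [DifferenceRing M] [Extension K M] {n : ℕ} {A : GL (Fin n) K}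
  {Z : FundamentalMatrix A S} {V : FundamentalMatrix A M} {ρ : S →ₐ[K] M ⊗[constants K] B}

theorem tensorExtend_σExt [Extension K S] (hρ : ∀ s, ρ (σ s) = σExt K M B (ρ s))
    (x : S ⊗[constants K] B) : tensorExtend ρ (σExt K S B x) = σExt K M B (tensorExtend ρ x) :=
  tensorLift_σExt (f := ρ) (g := Algebra.TensorProduct.includeRight)
    (τ := (σExt K M B : M ⊗[constants K] B →+* M ⊗[constants K] B)) hρ σExt_one_tmul x

variable (Z V) in
theorem FundamentalMatrix.exists_map_eq_mul [Nontrivial M] (hc : NoNewConstants K M)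
    (hρ : ∀ s, ρ (σ s) = σExt K M B (ρ s)) :
    ∃ P : GL (Fin n) B, GeneralLinearGroup.map (ρ : S →+* M ⊗[constants K] B) Z.mat =
      GeneralLinearGroup.map ((Algebra.TensorProduct.includeLeft : M →ₐ[K] M ⊗[constants K] B) :
        M →+* M ⊗[constants K] B) V.mat *
      GeneralLinearGroup.map ((Algebra.TensorProduct.includeRight :
        B →ₐ[constants K] M ⊗[constants K] B) : B →+* M ⊗[constants K] B) P := by
  have hQ := V.map_inv_mul_eq_self Z (τ := σExt K M B)
    (f := (Algebra.TensorProduct.includeLeft : M →ₐ[K] M ⊗[constants K] B)) (fun _ => rfl) hρ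
  obtain ⟨P, hP⟩ := (adjoinGL_le_range_iff (includeRight_injective K M B)).1 fun x hx => by
    refine hc.exists_one_tmul_eq (eqOn_adjoinGL (C := constants K)
      (φ := (σExt K M B : M ⊗[constants K] B →+* M ⊗[constants K] B)) (ψ := RingHom.id _)
      (fun c => ?_) (hQ.trans (by rw [GeneralLinearGroup.map_id]; rfl)) hx)
    exact (σExt_tmul K M B _ _).trans (congrArg (· ⊗ₜ 1) ((σConst K M).commutes c))
  exact ⟨P, by rw [hP, mul_inv_cancel_left]⟩

theorem tensorExtend_surjective [Nontrivial M] (hc : NoNewConstants K M) (hV : V.ring = ⊤)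
    (Z : FundamentalMatrix A S) (hρ : ∀ s, ρ (σ s) = σExt K M B (ρ s)) :
    Function.Surjective (tensorExtend ρ) := by
  let X := (tensorExtend ρ).range
  have hρX (s : S) : ρ s ∈ X := ⟨s ⊗ₜ 1, tensorExtend_tmul_one ρ s⟩
  have hBX (b : B) : (1 : M) ⊗ₜ b ∈ X := ⟨1 ⊗ₜ b, tensorExtend_one_tmul ρ b⟩
  obtain ⟨P, hP⟩ := Z.exists_map_eq_mul V hc hρ
  have hle := FundamentalMatrix.range_le (X := X) hV (ρ := Algebra.TensorProduct.includeLeft) <| by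
    rw [← mul_inv_eq_of_eq_mul hP]
    exact mul_mem (map_mem_range_map_val hρX _) (inv_mem (map_mem_range_map_val hBX P))
  intro x
  induction x with
  | zero => exact X.zero_mem
  | add x y hx hy => exact X.add_mem hx hy
  | tmul m b =>
    rw [tmul_eq]
    exact X.mul_mem (hle ⟨m, rfl⟩) (hBX b)

theorem tensorExtend_bijective [Extension K S] [Nontrivial M] (hs : IsSimple S)
    (hcS : NoNewConstants K S) (hcM : NoNewConstants K M) (hV : V.ring = ⊤)
    (Z : FundamentalMatrix A S) (hρ : ∀ s, ρ (σ s) = σExt K M B (ρ s)) :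
    Function.Bijective (tensorExtend ρ) :=
  ⟨hs.tensorLift_injective hcS (τ := σExt K M B) hρ σExt_one_tmul (includeRight_injective K M B),
    tensorExtend_surjective hcM hV Z hρ⟩

end Comparison

section Torsor

open Matrix

/-- The ring endomorphism `m ⊗ s ↦ σ m ⊗ σ s` of `M ⊗_K S`. -/
noncomputable def σTensor (K M S : Type*) [Field K] [DifferenceRing K] [CommRing M]
    [DifferenceRing M] [Algebra K M] [Extension K M] [CommRing S] [DifferenceRing S] [Algebra K S]
    [Extension K S] : M ⊗[K] S →+* M ⊗[K] S where
  toFun := TensorProduct.map (σSemilinear K M) (σSemilinear K S)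
  map_one' := by simp [Algebra.TensorProduct.one_def, σSemilinear]
  map_mul' x y := by
    induction x with
    | zero => simp
    | add x₁ x₂ h₁ h₂ => rw [add_mul, map_add, h₁, h₂, map_add, add_mul]
    | tmul a r =>
      induction y with
      | zero => simp
      | add y₁ y₂ h₁ h₂ => rw [mul_add, map_add, h₁, h₂, map_add, mul_add]
      | tmul b s => simp [σSemilinear]
  map_zero' := map_zero _
  map_add' := map_add _

variable {K S M B : Type u} [Field K] [DifferenceRing K] {n : ℕ} {A : GL (Fin n) K}
  [CommRing S] [DifferenceRing S] [Algebra K S]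
  [CommRing M] [DifferenceRing M] [Algebra K M]

/-- The coordinate ring `C[Y, 1/det Y]` of the torsor of equivariant homomorphisms from `S` to `M`,
where `C` is the field of constants of `K` and `Y = (V ⊗ 1)⁻¹ (1 ⊗ Z)`. -/
def torsorRing (V : FundamentalMatrix A M) (Z : FundamentalMatrix A S) :
    Subalgebra (constants K) (M ⊗[K] S) :=
  adjoinGL (constants K) <|
    (GeneralLinearGroup.map ((Algebra.TensorProduct.includeLeft : M →ₐ[K] M ⊗[K] S) :
      M →+* M ⊗[K] S) V.mat)⁻¹ *
    GeneralLinearGroup.map ((Algebra.TensorProduct.includeRight : S →ₐ[K] M ⊗[K] S) :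
      S →+* M ⊗[K] S) Z.mat

theorem torsorRing_finiteType (V : FundamentalMatrix A M) (Z : FundamentalMatrix A S) :
    Algebra.FiniteType (constants K) (torsorRing V Z) :=
  (Subalgebra.fg_iff_finiteType _).1 (adjoinGL_fg _)

variable [Extension K S] [Extension K M] [CommRing B] [Algebra (constants K) B]
  {Z : FundamentalMatrix A S}

theorem σTensor_tmul (m : M) (s : S) : σTensor K M S (m ⊗ₜ s) = σ m ⊗ₜ σ s := rfl

theorem σTensor_includeLeft (m : M) :
    (Algebra.TensorProduct.includeLeft : M →ₐ[K] M ⊗[K] S) (σ m) =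
      σTensor K M S ((Algebra.TensorProduct.includeLeft : M →ₐ[K] M ⊗[K] S) m) :=
  congrArg (σ m ⊗ₜ ·) (map_one (σ : S ≃+* S)).symm

theorem σTensor_includeRight (s : S) :
    (Algebra.TensorProduct.includeRight : S →ₐ[K] M ⊗[K] S) (σ s) =
      σTensor K M S ((Algebra.TensorProduct.includeRight : S →ₐ[K] M ⊗[K] S) s) :=
  congrArg (· ⊗ₜ σ s) (map_one (σ : M ≃+* M)).symm

theorem σTensor_torsorRing {V : FundamentalMatrix A M} (d : torsorRing V Z) :
    σTensor K M S d = d := by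
  refine eqOn_adjoinGL (φ := σTensor K M S) (ψ := RingHom.id _) (fun c => ?_) ?_ d.2
  · exact (σTensor_includeLeft _).symm.trans
      (congrArg (· ⊗ₜ 1) ((σConst K M).commutes c))
  · exact (V.map_inv_mul_eq_self Z σTensor_includeLeft σTensor_includeRight).trans
      (by rw [GeneralLinearGroup.map_id]; rfl)

theorem tensorLift_torsorRing_bijective (hs : IsSimple M) (hc : NoNewConstants K M)
    {V : FundamentalMatrix A M} (hZ : Z.ring = ⊤) : Function.Bijective
      (tensorLift (Algebra.TensorProduct.includeLeft : M →ₐ[K] M ⊗[K] S) (torsorRing V Z).val) := by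
  refine ⟨hs.tensorLift_injective hc σTensor_includeLeft σTensor_torsorRing
    Subtype.val_injective, ?_⟩
  let X := (tensorLift (Algebra.TensorProduct.includeLeft : M →ₐ[K] M ⊗[K] S)
    (torsorRing V Z).val).range
  have hMX (m : M) : m ⊗ₜ 1 ∈ X := ⟨m ⊗ₜ 1, tensorLift_tmul_one _ _ m⟩
  have hle := FundamentalMatrix.range_le (X := X) hZ
      (ρ := Algebra.TensorProduct.includeRight) <| by
    rw [← mul_inv_cancel_left (GeneralLinearGroup.map
      ((Algebra.TensorProduct.includeLeft : M →ₐ[K] M ⊗[K] S) : M →+* M ⊗[K] S) V.mat)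
      (GeneralLinearGroup.map _ Z.mat)]
    refine mul_mem (map_mem_range_map_val hMX _) ?_
    obtain ⟨Y, hY⟩ := (adjoinGL_le_range_iff (φ := (torsorRing V Z).val)
      Subtype.val_injective).1 (by rw [Subalgebra.range_val]; exact le_rfl)
    rw [← hY]
    exact map_mem_range_map_val (X := X) (fun d => ⟨1 ⊗ₜ d, tensorLift_one_tmul _ _ d⟩) Y
  intro x
  induction x with
  | zero => exact X.zero_mem
  | add x y hx hy => exact X.add_mem hx hy
  | tmul m s =>
    have hms : m ⊗ₜ[K] s = (m ⊗ₜ 1) * (1 ⊗ₜ s) := by simp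
    rw [hms]
    exact X.mul_mem (hMX m) (hle ⟨s, rfl⟩)

/-- The isomorphism `M ⊗_C C[Y, 1/det Y] ≃ M ⊗_K S`, for `S` generated by `Z`. -/
noncomputable def torsorEquiv (hs : IsSimple M) (hc : NoNewConstants K M)
    (V : FundamentalMatrix A M) (hZ : Z.ring = ⊤) :
    M ⊗[constants K] torsorRing V Z ≃ₐ[K] M ⊗[K] S :=
  AlgEquiv.ofBijective _ (tensorLift_torsorRing_bijective hs hc hZ)

/-- The universal equivariant homomorphism from `S` to an extension of constants of `M`. -/
noncomputable def torsorHom (hs : IsSimple M) (hc : NoNewConstants K M)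
    (V : FundamentalMatrix A M) (hZ : Z.ring = ⊤) : S →ₐ[K] M ⊗[constants K] torsorRing V Z :=
  (torsorEquiv hs hc V hZ).symm.toAlgHom.comp Algebra.TensorProduct.includeRight

variable (hs : IsSimple M) (hc : NoNewConstants K M) (V : FundamentalMatrix A M)
  (hZ : Z.ring = ⊤)

theorem torsorEquiv_tmul_one (m : M) : torsorEquiv hs hc V hZ (m ⊗ₜ 1) = m ⊗ₜ 1 :=
  tensorLift_tmul_one _ _ m

theorem torsorEquiv_one_tmul (d : torsorRing V Z) : torsorEquiv hs hc V hZ (1 ⊗ₜ d) = d :=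
  tensorLift_one_tmul _ _ d

theorem torsorEquiv_torsorHom (s : S) : torsorEquiv hs hc V hZ (torsorHom hs hc V hZ s) = 1 ⊗ₜ s :=
  (torsorEquiv hs hc V hZ).apply_symm_apply _

theorem torsorHom_σ (s : S) :
    torsorHom hs hc V hZ (σ s) = σExt K M (torsorRing V Z) (torsorHom hs hc V hZ s) := by
  refine (torsorEquiv hs hc V hZ).injective ?_
  calc torsorEquiv hs hc V hZ (torsorHom hs hc V hZ (σ s))
      = σTensor K M S (1 ⊗ₜ s) :=
      (torsorEquiv_torsorHom hs hc V hZ _).trans (σTensor_includeRight s)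
    _ = σTensor K M S (torsorEquiv hs hc V hZ (torsorHom hs hc V hZ s)) := by
      rw [torsorEquiv_torsorHom]
    _ = _ := (tensorLift_σExt σTensor_includeLeft σTensor_torsorRing _).symm

theorem exists_tensorMap_torsorHom {ρ : S →ₐ[K] M ⊗[constants K] B}
    (hρ : ∀ s, ρ (σ s) = σExt K M B (ρ s)) : ∃ f : torsorRing V Z →ₐ[constants K] B,
      ∀ s, tensorMap M f (torsorHom hs hc V hZ s) = ρ s := by
  have := hs.1
  let ρ' : M ⊗[K] S →ₐ[K] M ⊗[constants K] B :=
    Algebra.TensorProduct.lift Algebra.TensorProduct.includeLeft ρ fun _ _ => Commute.all _ _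
  have hρ' (x) : ρ' (σTensor K M S x) = σExt K M B (ρ' x) := by
    induction x with
    | zero => simp
    | add x y hx hy => simp only [map_add, hx, hy]
    | tmul m s => simp [ρ', σTensor_tmul, hρ, σExt_tmul]
  obtain ⟨f, hf⟩ := exists_comp_eq_of_range_le (includeRight_injective K M B)
    (g := (ρ'.restrictScalars (constants K)).comp (torsorRing V Z).val) <| by
      rintro _ ⟨d, rfl⟩
      exact hc.exists_one_tmul_eq ((hρ' d).symm.trans (congrArg ρ' (σTensor_torsorRing d)))
  have h : tensorMap M f = ρ'.comp (torsorEquiv hs hc V hZ).toAlgHom :=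
    algHom_tensor_ext
      (fun m => .trans (by simp [tensorMap, ρ'])
        (congrArg ρ' (torsorEquiv_tmul_one hs hc V hZ m)).symm)
      (fun d => (DFunLike.congr_fun hf d).trans
        (congrArg ρ' (torsorEquiv_one_tmul hs hc V hZ d)).symm)
  refine ⟨f, fun s => ?_⟩
  calc tensorMap M f (torsorHom hs hc V hZ s)
      = ρ' (torsorEquiv hs hc V hZ (torsorHom hs hc V hZ s)) := DFunLike.congr_fun h _
    _ = ρ s := by
      rw [torsorEquiv_torsorHom]
      simp [ρ', ← Algebra.TensorProduct.one_def]

theorem torsorHom_hom_ext {f f' : torsorRing V Z →ₐ[constants K] B}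
    (h : ∀ s, tensorMap M f (torsorHom hs hc V hZ s) = tensorMap M f' (torsorHom hs hc V hZ s)) :
    f = f' := by
  have := hs.1
  have hm (g : torsorRing V Z →ₐ[constants K] B) (m : M) :
      tensorMap M g ((torsorEquiv hs hc V hZ).symm (m ⊗ₜ 1)) = m ⊗ₜ 1 := by
    rw [← torsorEquiv_tmul_one hs hc V hZ, AlgEquiv.symm_apply_apply]
    simp [tensorMap]
  have heq : (tensorMap M f).comp (torsorEquiv hs hc V hZ).symm.toAlgHom =
      (tensorMap M f').comp (torsorEquiv hs hc V hZ).symm.toAlgHom :=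
    Algebra.TensorProduct.ext (AlgHom.ext fun m => (hm f m).trans (hm f' m).symm) (AlgHom.ext h)
  refine AlgHom.ext fun d => includeRight_injective K M B ?_
  simpa [tensorMap] using DFunLike.congr_fun heq (torsorEquiv hs hc V hZ (1 ⊗ₜ d))

end Torsor

section Representability

variable {K M B : Type u} [Field K] [DifferenceRing K] [CommRing M] [DifferenceRing M]
  [Algebra K M] [Extension K M] [CommRing B] [Algebra (constants K) B]

theorem galoisPoints_ext {φ ψ : galoisPoints K M B} (h : ∀ m, φ.1 (m ⊗ₜ 1) = ψ.1 (m ⊗ₜ 1)) :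
    φ = ψ :=
  Subtype.ext <| AlgEquiv.ext fun x => DFunLike.congr_fun (x := x) <|
    algHom_tensor_ext (φ := φ.1.toAlgHom) (ψ := ψ.1.toAlgHom) h fun b =>
      (φ.2.1 b).trans (ψ.2.1 b).symm

theorem galoisMap_tmul_one {B' : Type u} [CommRing B'] [Algebra (constants K) B']
    (f : B →ₐ[constants K] B') (φ : galoisPoints K M B) (m : M) :
    (galoisMap f φ).1 (m ⊗ₜ 1) = tensorMap M f (φ.1 (m ⊗ₜ 1)) := by
  refine (extendHom_tmul f φ.1 m 1).trans ?_
  rw [← Algebra.TensorProduct.one_def, mul_one]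

variable {n : ℕ} {A : GL (Fin n) K}

theorem exists_galoisPoint (hM : IsPicardVessiotRing A M) (hc : NoNewConstants K M)
    {ρ : M →ₐ[K] M ⊗[constants K] B} (hρ : ∀ m, ρ (σ m) = σExt K M B (ρ m)) :
    ∃ φ : galoisPoints K M B, ∀ m, φ.1 (m ⊗ₜ 1) = ρ m := by
  obtain ⟨⟨Z, hZ⟩, hs⟩ := hM
  have := hs.1
  exact ⟨⟨AlgEquiv.ofBijective _ (tensorExtend_bijective hs hc hc hZ Z hρ),
    tensorExtend_one_tmul ρ, tensorExtend_σExt hρ⟩, tensorExtend_tmul_one ρ⟩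

theorem existsUnique_galoisMap_eq {Z : FundamentalMatrix A M} (hs : IsSimple M)
    (hc : NoNewConstants K M) (hZ : Z.ring = ⊤) {g : galoisPoints K M (torsorRing Z Z)}
    (hg : ∀ m, g.1 (m ⊗ₜ 1) = torsorHom hs hc Z hZ m) (φ : galoisPoints K M B) :
    ∃! f : torsorRing Z Z →ₐ[constants K] B, galoisMap f g = φ := by
  have hφ (m : M) : φ.1 (σ m ⊗ₜ 1) = σExt K M B (φ.1 (m ⊗ₜ 1)) := by
    rw [← φ.2.2, σExt_tmul]
  obtain ⟨f, hf⟩ := exists_tensorMap_torsorHom hs hc Z hZ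
    (ρ := φ.1.toAlgHom.comp Algebra.TensorProduct.includeLeft) hφ
  have heq : galoisMap f g = φ := galoisPoints_ext fun m => by
    rw [galoisMap_tmul_one, hg, hf]
    rfl
  refine ⟨f, heq, fun f' hf' => torsorHom_hom_ext hs hc Z hZ fun m => ?_⟩
  rw [← hg, ← galoisMap_tmul_one, ← galoisMap_tmul_one, hf', heq]

theorem isLinearAlgebraicGroup_galoisGroup (hM : IsPicardVessiotRing A M)
    (hc : NoNewConstants K M) : IsLinearAlgebraicGroup (galoisGroup K M) := by
  obtain ⟨⟨Z, hZ⟩, hs⟩ := id hM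
  obtain ⟨g, hg⟩ := exists_galoisPoint hM hc (torsorHom_σ hs hc Z hZ)
  have huniv (B : CommAlgCat.{u} (constants K)) (φ : galoisPoints K M B) :=
    existsUnique_galoisMap_eq hs hc hZ hg φ
  refine ⟨CommAlgCat.of _ (torsorRing Z Z), torsorRing_finiteType Z Z, ⟨⟨fun {B} =>
    Equiv.ofBijective (fun f => (galoisMap f.hom g : galoisPoints K M B)) ⟨fun f f' h => ?_,
      fun φ => ?_⟩, fun h f => galoisMap_comp h.hom f.hom g⟩⟩⟩
  · exact CommAlgCat.hom_ext ((huniv B _).unique h rfl)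
  · exact (huniv B φ).exists.imp' CommAlgCat.ofHom fun _ => id

end Representability

section BaseField

variable {k K R : Type u} [Field k] [Field K] [Algebra k K] [CommRing R] [Algebra k R]

namespace BaseChange

noncomputable instance : Algebra k (BaseChange k K R) := inferInstanceAs (Algebra k (K ⊗[k] R))

instance : IsScalarTower k K (BaseChange k K R) :=
  inferInstanceAs (IsScalarTower k K (K ⊗[k] R))

instance [Nontrivial R] : Nontrivial (BaseChange k K R) :=
  inferInstanceAs (Nontrivial (K ⊗[k] R))

variable (k K R) in
/-- The homomorphism `r ↦ 1 ⊗ r` from `R` to `K ⊗_k R`. -/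
noncomputable def incl : R →ₐ[k] BaseChange k K R :=
  (Algebra.TensorProduct.includeRight : R →ₐ[k] K ⊗[k] R)

theorem incl_apply (r : R) : incl k K R r = mk k 1 r := rfl

theorem mk_eq (a : K) (r : R) : mk k a r = algebraMap K (BaseChange k K R) a * incl k K R r := by
  refine Eq.trans ?_ (Algebra.TensorProduct.tmul_mul_tmul a 1 1 r).symm
  rw [mul_one, one_mul]
  rfl

theorem induction {P : BaseChange k K R → Prop} (zero : P 0)
    (add : ∀ x y, P x → P y → P (x + y))
    (mul : ∀ a r, P (algebraMap K _ a * incl k K R r)) (x : BaseChange k K R) : P x :=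
  TensorProduct.induction_on (motive := P) x zero
    (fun a r => (mk_eq (k := k) a r).symm.subst (motive := P) (mul a r)) add

variable {N : Type*} [CommRing N] [Algebra K N]

theorem algHom_ext {f g : BaseChange k K R →ₐ[K] N}
    (h : ∀ r, f (incl k K R r) = g (incl k K R r)) : f = g :=
  AlgHom.ext fun x => by
    induction x using induction with
    | zero => simp
    | add x y hx hy => rw [map_add, map_add, hx, hy]
    | mul a r => rw [map_mul, map_mul, h, f.commutes, g.commutes]

variable [Algebra k N] [IsScalarTower k K N]

/-- The `K`-linear extension to `K ⊗_k R` of a homomorphism out of `R`. -/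
noncomputable def lift (g : R →ₐ[k] N) : BaseChange k K R →ₐ[K] N :=
  (Algebra.TensorProduct.lift (Algebra.ofId K N) g fun _ _ => Commute.all _ _ : K ⊗[k] R →ₐ[K] N)

theorem lift_incl (g : R →ₐ[k] N) (r : R) : lift g (incl k K R r) = g r :=
  (Algebra.TensorProduct.lift_tmul ..).trans (by rw [map_one, one_mul])

variable [DifferenceRing k] [DifferenceRing K] [Extension k K] [DifferenceRing R] [Extension k R]

theorem incl_σ (r : R) : incl k K R (σ r) = σ (incl k K R r) := by
  rw [incl_apply, incl_apply, σ_mk, map_one]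

theorem lift_σ {g : R →ₐ[k] N} {τ : N →+* N}
    (hτ : ∀ a, τ (algebraMap K N a) = algebraMap K N (σ a)) (hg : ∀ r, g (σ r) = τ (g r))
    (x : BaseChange k K R) : lift g (σ x) = τ (lift g x) := by
  induction x using induction with
  | zero => simp
  | add x y hx hy => simp only [map_add, hx, hy]
  | mul a r =>
    rw [map_mul, map_mul, map_mul, map_mul, Extension.σ_algebraMap, AlgHom.commutes,
      AlgHom.commutes, hτ, ← incl_σ, lift_incl, lift_incl, hg]

end BaseChange

variable [DifferenceRing k] [DifferenceRing K] [Extension k K]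

section BaseLift

variable {B N : Type u} [CommRing B] [Algebra (constants k) B] [Algebra (constants K) B]
  [IsScalarTower (constants k) (constants K) B] [CommRing N] [Algebra k N] [Algebra K N]
  [IsScalarTower k K N]

instance : IsScalarTower (constants k) (constants K) N :=
  IsScalarTower.of_algebraMap_eq fun c => IsScalarTower.algebraMap_apply k K N c

/-- The homomorphism `r ⊗ b ↦ f (1 ⊗ r) * g b` out of `R ⊗_C B`, where `C` is the field of
constants of `k`, given by homomorphisms out of `K ⊗_k R` and out of `B` that are linear over `K`
and over its constants. -/
noncomputable def baseLift (f : BaseChange k K R →ₐ[K] N) (g : B →ₐ[constants K] N) :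
    R ⊗[constants k] B →ₐ[k] N :=
  tensorLift ((f.restrictScalars k).comp (BaseChange.incl k K R))
    (g.restrictScalars (constants k))

variable [DifferenceRing R] [Extension k R] {f : BaseChange k K R →ₐ[K] N}
  {g : B →ₐ[constants K] N} {τ : N →+* N}

theorem baseLift_σExt (hf : ∀ s, f (σ s) = τ (f s)) (hg : ∀ b, τ (g b) = g b)
    (x : R ⊗[constants k] B) : baseLift f g (σExt k R B x) = τ (baseLift f g x) :=
  tensorLift_σExt (f := (f.restrictScalars k).comp (BaseChange.incl k K R))
    (g := g.restrictScalars (constants k))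
    (fun r => (congrArg f (BaseChange.incl_σ r)).trans (hf _)) hg x

theorem IsSimple.baseLift_injective (hs : IsSimple R) (hc : NoNewConstants k R)
    (hf : ∀ s, f (σ s) = τ (f s)) (hg : ∀ b, τ (g b) = g b) (hinj : Function.Injective g) :
    Function.Injective (baseLift f g) :=
  hs.tensorLift_injective hc (f := (f.restrictScalars k).comp (BaseChange.incl k K R))
    (g := g.restrictScalars (constants k))
    (fun r => (congrArg f (BaseChange.incl_σ r)).trans (hf _)) hg hinj

end BaseLift

variable [DifferenceRing R] [Extension k R] {n : ℕ} {A : GL (Fin n) k}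

namespace FundamentalMatrix

open Matrix

variable (K) in
/-- The fundamental matrix `1 ⊗ Z` of `K ⊗_k R`. -/
noncomputable def baseChange (Z : FundamentalMatrix A R) :
    FundamentalMatrix (GeneralLinearGroup.map (algebraMap k K) A) (BaseChange k K R) where
  mat := GeneralLinearGroup.map (BaseChange.incl k K R : R →+* BaseChange k K R) Z.mat
  map_σ := by
    rw [Z.map_map_of_equivariant BaseChange.incl_σ, IsScalarTower.algebraMap_eq k K]
    rfl

theorem baseChange_ring {Z : FundamentalMatrix A R} (hZ : Z.ring = ⊤) :
    (Z.baseChange K).ring = ⊤ := by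
  have hle : (BaseChange.incl k K R).range ≤ (Z.baseChange K).ring.restrictScalars k :=
    range_le hZ <| (adjoinGL_le_range_iff (C := K) (φ := (Z.baseChange K).ring.val)
      Subtype.val_injective).1 (Subalgebra.range_val _).ge
  refine Algebra.eq_top_iff.2 fun x => ?_
  induction x using BaseChange.induction with
  | zero => exact Subalgebra.zero_mem _
  | add x y hx hy => exact Subalgebra.add_mem _ hx hy
  | mul a r => exact Subalgebra.mul_mem _ (Subalgebra.algebraMap_mem _ a) (hle ⟨r, rfl⟩)

end FundamentalMatrix

end BaseField

section ConstantGeneration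

variable {k K R : Type u} [Field k] [DifferenceRing k] [Field K] [DifferenceRing K] [Algebra k K]
  [Extension k K] [CommRing R] [Algebra k R]

variable (k K R) in
/-- The homomorphism `r ⊗ c ↦ c ⊗ r` from `R ⊗_{C_k} C_K` to `K ⊗_k R`; if `K = k(C_K)` it is a
localization. -/
noncomputable def constantsHom : R ⊗[constants k] constants K →ₐ[k] BaseChange k K R :=
  baseLift (AlgHom.id K _) (Algebra.ofId (constants K) _)

theorem constantsHom_tmul (r : R) (c : constants K) :
    constantsHom k K R (r ⊗ₜ c) = BaseChange.incl k K R r * algebraMap K _ c := rfl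

theorem algebraMap_mem_range_constantsHom {a : K}
    (ha : a ∈ Algebra.adjoin k (constants K : Set K)) :
    algebraMap K (BaseChange k K R) a ∈ (constantsHom k K R).range := by
  have hle : Algebra.adjoin k (constants K : Set K) ≤
      (constantsHom k K R).range.comap (IsScalarTower.toAlgHom k K (BaseChange k K R)) :=
    Algebra.adjoin_le fun c hc =>
      ⟨1 ⊗ₜ ⟨c, hc⟩, (constantsHom_tmul _ _).trans (by rw [map_one, one_mul]; rfl)⟩
  exact hle ha

theorem incl_mem_range_constantsHom (r : R) :
    BaseChange.incl k K R r ∈ (constantsHom k K R).range :=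
  ⟨r ⊗ₜ 1, (constantsHom_tmul _ _).trans (by rw [OneMemClass.coe_one, map_one, mul_one])⟩

theorem exists_algebraMap_mul_mem_range_constantsHom
    (hK : IntermediateField.adjoin k (constants K : Set K) = ⊤) (x : BaseChange k K R) :
    ∃ a ∈ Algebra.adjoin k (constants K : Set K), a ≠ 0 ∧
      algebraMap K _ a * x ∈ (constantsHom k K R).range := by
  induction x using BaseChange.induction with
  | zero => exact ⟨1, one_mem _, one_ne_zero, by simp⟩
  | add x y hx hy =>
    obtain ⟨a, ha, ha0, hx⟩ := hx
    obtain ⟨b, hb, hb0, hy⟩ := hy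
    have hab : algebraMap K (BaseChange k K R) (a * b) * (x + y) =
        algebraMap K _ b * (algebraMap K _ a * x) + algebraMap K _ a * (algebraMap K _ b * y) := by
      rw [map_mul]
      ring
    exact ⟨a * b, mul_mem ha hb, mul_ne_zero ha0 hb0, hab ▸
      add_mem (mul_mem (algebraMap_mem_range_constantsHom hb) hx)
        (mul_mem (algebraMap_mem_range_constantsHom ha) hy)⟩
  | mul a r =>
    obtain ⟨p, hp, q, hq, rfl⟩ :=
      IntermediateField.mem_adjoin_iff_div.1 (hK ▸ IntermediateField.mem_top (x := a))
    rcases eq_or_ne q 0 with rfl | hq0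
    · exact ⟨1, one_mem _, one_ne_zero, by simp⟩
    · refine ⟨q, hq, hq0, ?_⟩
      rw [← mul_assoc, ← map_mul, mul_div_cancel₀ _ hq0]
      exact mul_mem (algebraMap_mem_range_constantsHom hp) (incl_mem_range_constantsHom r)

variable [DifferenceRing R] [Extension k R]

theorem constantsHom_σExt (x : R ⊗[constants k] constants K) :
    constantsHom k K R (σExt k R (constants K) x) = σ (constantsHom k K R x) :=
  baseLift_σExt (f := AlgHom.id K _) (g := Algebra.ofId (constants K) _)
    (τ := ((σ : BaseChange k K R ≃+* BaseChange k K R) : BaseChange k K R →+* BaseChange k K R))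
    (fun _ => rfl)
    (σConst K (BaseChange k K R)).commutes x

theorem IsSimple.constantsHom_injective (hs : IsSimple R) (hc : NoNewConstants k R) :
    Function.Injective (constantsHom k K R) :=
  have := hs.1
  hs.baseLift_injective hc (τ := ((σ : BaseChange k K R ≃+* _) : BaseChange k K R →+* _))
    (fun _ => rfl) (σConst K (BaseChange k K R)).commutes
    (algebraMap (constants K) (BaseChange k K R)).injective

theorem IsSimple.baseChange (hs : IsSimple R) (hc : NoNewConstants k R)
    (hK : IntermediateField.adjoin k (constants K : Set K) = ⊤) : IsSimple (BaseChange k K R) := by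
  have := hs.1
  refine ⟨inferInstance, fun I hI => ?_⟩
  have hJ : ∀ x ∈ I.comap (constantsHom k K R),
      σExt k R (constants K) x ∈ I.comap (constantsHom k K R) := fun x hx => by
    rw [Ideal.mem_comap, constantsHom_σExt]
    exact hI _ hx
  refine (hs.eq_bot_or_eq_top_of_invariant hc hJ).imp (fun h => ?_) Ideal.comap_eq_top_iff.1
  refine (Submodule.eq_bot_iff I).2 fun x hx => ?_
  obtain ⟨a, -, ha, y, hy⟩ := exists_algebraMap_mul_mem_range_constantsHom hK x
  have hy0 : y = 0 := by
    rw [← Ideal.mem_bot, ← h, Ideal.mem_comap]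
    exact hy.symm ▸ I.mul_mem_left _ hx
  rw [hy0] at hy
  exact ((IsUnit.mk0 a ha).map (algebraMap K _)).mul_right_eq_zero.1 (hy.symm.trans (map_zero _))

/- The denominators of a constant `x` of `K ⊗_k R` form a nonzero invariant ideal of
`R ⊗_{C_k} C_K`, which is therefore everything. -/
theorem NoNewConstants.baseChange (hs : IsSimple R) (hc : NoNewConstants k R)
    (hK : IntermediateField.adjoin k (constants K : Set K) = ⊤) :
    NoNewConstants K (BaseChange k K R) := by
  intro x hx
  have := hs.1
  let J : Ideal (R ⊗[constants k] constants K) :=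
    { carrier := {y | ∃ z, constantsHom k K R z = constantsHom k K R y * x}
      add_mem' := fun ⟨z, hz⟩ ⟨z', hz'⟩ => ⟨z + z', by rw [map_add, map_add, add_mul, hz, hz']⟩
      zero_mem' := ⟨0, by rw [map_zero, zero_mul]⟩
      smul_mem' := fun w y ⟨z, hz⟩ => ⟨w * z, by
        rw [smul_eq_mul, map_mul, map_mul, hz, mul_assoc]⟩ }
  have hJ : ∀ y ∈ J, σExt k R (constants K) y ∈ J := fun y ⟨z, hz⟩ =>
    ⟨σExt k R (constants K) z, by
      rw [constantsHom_σExt, hz, map_mul, hx, constantsHom_σExt]⟩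
  have hJ0 : J ≠ ⊥ := fun h => by
    obtain ⟨a, ha, ha0, z, hz⟩ := exists_algebraMap_mul_mem_range_constantsHom hK x
    obtain ⟨y, hy⟩ := algebraMap_mem_range_constantsHom (R := R) ha
    have hyJ : y ∈ J := ⟨z, hz.trans (congrArg (· * x) hy.symm)⟩
    rw [h, Ideal.mem_bot] at hyJ
    refine ha0 ((map_eq_zero (algebraMap K (BaseChange k K R))).1 (hy.symm.trans ?_))
    rw [hyJ]
    exact map_zero _
  obtain ⟨z, hz⟩ : 1 ∈ J := (Ideal.eq_top_iff_one J).1 <|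
    (hs.eq_bot_or_eq_top_of_invariant hc hJ).resolve_left hJ0
  rw [map_one, one_mul] at hz
  obtain ⟨c, rfl⟩ := hc.exists_one_tmul_eq <| hs.constantsHom_injective hc <|
    (constantsHom_σExt z).trans (by rw [hz, hx])
  rw [constantsHom_tmul, map_one, one_mul] at hz
  exact ⟨c, c.2, hz⟩

end ConstantGeneration

section Descent

open Matrix

variable {K L S F : Type u} [Field K] [DifferenceRing K] {n : ℕ} {A : GL (Fin n) K}
  [CommRing L] [DifferenceRing L] [Algebra K L]
  [CommRing S] [DifferenceRing S] [Algebra K S]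
  [Field F] [Algebra (constants K) F]

namespace FundamentalMatrix

theorem noNewConstants_ring [Extension K L] (hc : NoNewConstants K L) (V : FundamentalMatrix A L) :
    NoNewConstants K V.ring := fun x hx =>
  let ⟨c, hc, h⟩ := hc x (congrArg Subtype.val hx)
  ⟨c, hc, Subtype.ext h⟩

/-- The inclusion of `K[V, 1/det V] ⊗_C B` into `L ⊗_C B`, where `C` is the field of constants
of `K`. -/
noncomputable def tensorVal (B : Type u) [CommRing B] [Algebra (constants K) B]
    (V : FundamentalMatrix A L) : V.ring ⊗[constants K] B →ₐ[K] L ⊗[constants K] B :=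
  Algebra.TensorProduct.map V.ring.val (AlgHom.id _ B)

variable {B : Type u} [CommRing B] [Algebra (constants K) B] (V : FundamentalMatrix A L)

theorem tensorVal_injective : Function.Injective (V.tensorVal B) :=
  Module.Flat.rTensor_preserves_injective_linearMap
    (V.ring.val.restrictScalars (constants K)).toLinearMap Subtype.val_injective

variable [Extension K L]

theorem tensorVal_σExt (x : V.ring ⊗[constants K] B) :
    V.tensorVal B (σExt K V.ring B x) = σExt K L B (V.tensorVal B x) := by
  induction x with
  | zero => simp
  | add x y hx hy => simp only [map_add, hx, hy]
  | tmul x b => rfl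

theorem exists_tensorVal_comp_eq [Nontrivial L] (hc : NoNewConstants K L)
    {Z : FundamentalMatrix A S} (hZ : Z.ring = ⊤) {ρ : S →ₐ[K] L ⊗[constants K] B}
    (hρ : ∀ s, ρ (σ s) = σExt K L B (ρ s)) :
    ∃ ρ' : S →ₐ[K] V.ring ⊗[constants K] B, (V.tensorVal B).comp ρ' = ρ := by
  obtain ⟨P, hP⟩ := Z.exists_map_eq_mul V hc hρ
  obtain ⟨W, hW⟩ := (adjoinGL_le_range_iff (φ := V.ring.val) Subtype.val_injective).1
    V.ring.range_val.ge
  refine exists_comp_eq_of_range_le V.tensorVal_injective ?_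
  rw [range_eq_adjoinGL hZ, adjoinGL_le_range_iff V.tensorVal_injective, hP]
  refine mul_mem ⟨GeneralLinearGroup.map ((Algebra.TensorProduct.includeLeft :
    V.ring →ₐ[K] V.ring ⊗[constants K] B) : V.ring →+* _) W, ?_⟩ ⟨GeneralLinearGroup.map
      ((Algebra.TensorProduct.includeRight : B →ₐ[constants K] V.ring ⊗[constants K] B) :
        B →+* _) P, ?_⟩
  · rw [← hW]
    exact GeneralLinearGroup.ext fun _ _ => rfl
  · exact GeneralLinearGroup.ext fun _ _ => Algebra.TensorProduct.map_tmul ..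

theorem exists_equivariant_algHom [Extension K S] [Nontrivial S] [IsAlgClosed F] (hs : IsSimple L)
    (hc : NoNewConstants K L) {Z : FundamentalMatrix A S} (hZ : Z.ring = ⊤) :
    ∃ ρ : S →ₐ[K] V.ring ⊗[constants K] F, ∀ s, ρ (σ s) = σExt K V.ring F (ρ s) := by
  have := hs.1
  have := torsorRing_finiteType V Z
  obtain ⟨f⟩ := nonempty_algHom_of_isAlgClosed (C := constants K) (F := F) (D := torsorRing V Z)
  have hρ (s : S) : (tensorMap L f).comp (torsorHom hs hc V hZ) (σ s) =
      σExt K L F ((tensorMap L f).comp (torsorHom hs hc V hZ) s) := by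
    rw [AlgHom.comp_apply, torsorHom_σ, tensorMap_σExt, AlgHom.comp_apply]
  obtain ⟨ρ, h⟩ := V.exists_tensorVal_comp_eq hc hZ hρ
  refine ⟨ρ, fun s => V.tensorVal_injective ?_⟩
  rw [tensorVal_σExt]
  exact (DFunLike.congr_fun h _).trans ((hρ s).trans (congrArg _ (DFunLike.congr_fun h s).symm))

end FundamentalMatrix

theorem IsSimple.of_tensor [Extension K S] {M : Type u} [CommRing M] [DifferenceRing M]
    [Algebra K M] [Extension K M] [Nontrivial M] (hs : IsSimple S) (hc : NoNewConstants K S)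
    {Φ : S ⊗[constants K] F →+* M ⊗[constants K] F} (hΦ : Function.Surjective Φ)
    (hσ : ∀ x, Φ (σExt K S F x) = σExt K M F (Φ x)) : IsSimple M := by
  refine ⟨inferInstance, fun I hI => ?_⟩
  let e := algebraMap M (M ⊗[constants K] F)
  have hcomap : (I.map e).comap e = I := Ideal.comap_map_eq_self_of_faithfullyFlat I
  have hI' : I.map e ≤ (I.map e).comap (σExt K M F : M ⊗[constants K] F →+* _) :=
    Ideal.map_le_iff_le_comap.2 fun x hx => Ideal.mem_map_of_mem e (hI x hx)
  have hJ : ∀ x ∈ (I.map e).comap Φ, σExt K S F x ∈ (I.map e).comap Φ := fun x hx => by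
    rw [Ideal.mem_comap, hσ]
    exact hI' hx
  have hmap := Ideal.map_comap_of_surjective Φ hΦ (I.map e)
  refine (hs.eq_bot_or_eq_top_of_invariant hc hJ).imp (fun h => ?_) fun h => ?_
  · rw [h, Ideal.map_bot] at hmap
    rw [← hcomap, ← hmap]
    exact (RingHom.injective_iff_ker_eq_bot e).1 (FaithfulSMul.algebraMap_injective _ _)
  · rw [← hcomap, Ideal.comap_eq_top_iff, ← hmap, h, Ideal.map_top]

end Descent

section GaloisPoints

variable {K S M B : Type u} [Field K] [DifferenceRing K] [CommRing S] [Algebra K S] [CommRing M]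
  [Algebra K M] [CommRing B] [Algebra (constants K) B]

theorem tensorMap_comp {B' B'' : Type u} [CommRing B'] [Algebra (constants K) B'] [CommRing B'']
    [Algebra (constants K) B''] (g : B' →ₐ[constants K] B'') (f : B →ₐ[constants K] B') :
    tensorMap M (g.comp f) = (tensorMap M g).comp (tensorMap M f) :=
  Algebra.TensorProduct.ext' fun _ _ => rfl

variable [DifferenceRing M] [Extension K M] {ρ ψ : S →ₐ[K] M ⊗[constants K] B}

theorem galoisPoints_ext_of_surjective (hsurj : Function.Surjective (tensorExtend ρ))
    {θ θ' : galoisPoints K M B} (h : ∀ s, θ.1 (ρ s) = θ'.1 (ρ s)) : θ = θ' := by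
  refine Subtype.ext <| AlgEquiv.ext <| hsurj.forall.2 fun x => DFunLike.congr_fun (x := x) <|
    algHom_tensor_ext (φ := θ.1.toAlgHom.comp (tensorExtend ρ))
      (ψ := θ'.1.toAlgHom.comp (tensorExtend ρ)) (fun s => ?_) fun b => ?_
  · rw [AlgHom.comp_apply, AlgHom.comp_apply, tensorExtend_tmul_one]
    exact h s
  · rw [AlgHom.comp_apply, AlgHom.comp_apply, tensorExtend_one_tmul]
    exact (θ.2.1 b).trans (θ'.2.1 b).symm

theorem exists_galoisPoint_map_eq [DifferenceRing S] [Extension K S]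
    (hρ : ∀ s, ρ (σ s) = σExt K M B (ρ s)) (hρbij : Function.Bijective (tensorExtend ρ))
    (hψ : ∀ s, ψ (σ s) = σExt K M B (ψ s)) (hψbij : Function.Bijective (tensorExtend ψ)) :
    ∃ θ : galoisPoints K M B, ∀ s, θ.1 (ρ s) = ψ s := by
  let θ := (AlgEquiv.ofBijective _ hρbij).symm.trans (AlgEquiv.ofBijective _ hψbij)
  have hθ (x) : θ (tensorExtend ρ x) = tensorExtend ψ x :=
    congrArg (tensorExtend ψ) ((AlgEquiv.ofBijective _ hρbij).symm_apply_apply x)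
  refine ⟨⟨θ, fun b => ?_, hρbij.2.forall.2 fun x => ?_⟩, fun s => ?_⟩
  · rw [← tensorExtend_one_tmul ρ, hθ, tensorExtend_one_tmul, tensorExtend_one_tmul]
  · rw [← tensorExtend_σExt hρ, hθ, hθ, tensorExtend_σExt hψ]
  · rw [← tensorExtend_tmul_one ρ, ← tensorExtend_tmul_one ψ, ← hθ]

end GaloisPoints

section GaloisComparison

open Matrix

variable {k K R M B : Type u} [Field k] [DifferenceRing k] [Field K] [DifferenceRing K]
  [Algebra k K] [Extension k K] [CommRing R] [Algebra k R] [CommRing M] [Algebra k M] [Algebra K M]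
  [IsScalarTower k K M] [CommRing B] [Algebra (constants k) B] [Algebra (constants K) B]
  [IsScalarTower (constants k) (constants K) B]

/-- The homomorphism `r ⊗ b ↦ ρ (1 ⊗ r) * (1 ⊗ b)` from `R ⊗_C B` to `M ⊗_{C'} B`, where `C` and
`C'` are the fields of constants of `k` and `K`, along which the `B`-points of the Galois groups
of `R` and `M` are compared. -/
noncomputable def comparisonHom (ρ : BaseChange k K R →ₐ[K] M ⊗[constants K] B) :
    R ⊗[constants k] B →ₐ[k] M ⊗[constants K] B :=
  baseLift ρ Algebra.TensorProduct.includeRight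

section Basic

variable (ρ : BaseChange k K R →ₐ[K] M ⊗[constants K] B)

theorem comparisonHom_tmul (r : R) (b : B) : comparisonHom ρ (r ⊗ₜ b) =
    tensorExtend ρ (BaseChange.mk k 1 r ⊗ₜ b) := rfl

theorem comparisonHom_tmul_one (r : R) :
    comparisonHom ρ (r ⊗ₜ 1) = ρ (BaseChange.incl k K R r) := by
  rw [comparisonHom_tmul, tensorExtend_tmul_one, BaseChange.incl_apply]

theorem comparisonHom_one_tmul (b : B) : comparisonHom ρ ((1 : R) ⊗ₜ b) = 1 ⊗ₜ b :=
  tensorExtend_one_tmul ρ b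

theorem comparisonHom_tensorMap {B' : Type u} [CommRing B'] [Algebra (constants k) B']
    [Algebra (constants K) B'] [IsScalarTower (constants k) (constants K) B']
    (g : B →ₐ[constants K] B') (x : R ⊗[constants k] B) :
    comparisonHom ((tensorMap M g).comp ρ) (tensorMap R (g.restrictScalars (constants k)) x) =
      tensorMap M g (comparisonHom ρ x) := by
  have hB (b : B) : tensorMap M g (1 ⊗ₜ b) = 1 ⊗ₜ g b := by
    rw [tensorMap, Algebra.TensorProduct.map_tmul, map_one]
  induction x with
  | zero => simp
  | add x y hx hy => simp only [map_add, hx, hy]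
  | tmul r b =>
    refine Eq.trans ?_ (map_mul (tensorMap M g) (ρ (BaseChange.incl k K R r)) (1 ⊗ₜ b)).symm
    rw [hB]
    rfl

variable {ρ} [DifferenceRing R] [Extension k R] [DifferenceRing M] [Extension K M]

theorem comparisonHom_σExt (hρ : ∀ s, ρ (σ s) = σExt K M B (ρ s)) (x : R ⊗[constants k] B) :
    comparisonHom ρ (σExt k R B x) = σExt K M B (comparisonHom ρ x) :=
  baseLift_σExt (f := ρ) (g := Algebra.TensorProduct.includeRight)
    (τ := (σExt K M B : M ⊗[constants K] B →+* M ⊗[constants K] B)) hρ σExt_one_tmul x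

theorem comparisonHom_injective [Nontrivial M] (hs : IsSimple R) (hc : NoNewConstants k R)
    (hρ : ∀ s, ρ (σ s) = σExt K M B (ρ s)) : Function.Injective (comparisonHom ρ) :=
  hs.baseLift_injective hc (τ := σExt K M B) hρ σExt_one_tmul (includeRight_injective K M B)

end Basic

variable [DifferenceRing R] [Extension k R] [DifferenceRing M] [Extension K M]
  {ρ : BaseChange k K R →ₐ[K] M ⊗[constants K] B}

/-- The relation `θ ∘ ι = ι ∘ φ` between `B`-points `φ` and `θ` of the Galois groups of `R` and
`M`, where `ι` is the comparison homomorphism given by `ρ`. -/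
def Intertwines (ρ : BaseChange k K R →ₐ[K] M ⊗[constants K] B) (φ : galoisPoints k R B)
    (θ : galoisPoints K M B) : Prop :=
  ∀ x, θ.1 (comparisonHom ρ x) = comparisonHom ρ (φ.1 x)

namespace Intertwines

theorem of_tmul_one {φ : galoisPoints k R B} {θ : galoisPoints K M B}
    (h : ∀ r, θ.1 (ρ (BaseChange.incl k K R r)) = comparisonHom ρ (φ.1 (r ⊗ₜ 1))) :
    Intertwines ρ φ θ := by
  intro x
  induction x with
  | zero => simp
  | add x y hx hy => simp only [map_add, hx, hy]
  | tmul r b =>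
    rw [tmul_eq, map_mul, map_mul, map_mul, map_mul, comparisonHom_tmul_one, h,
      comparisonHom_one_tmul, θ.2.1, φ.2.1, comparisonHom_one_tmul]

theorem mul {φ φ' : galoisPoints k R B} {θ θ' : galoisPoints K M B} (h : Intertwines ρ φ θ)
    (h' : Intertwines ρ φ' θ') : Intertwines ρ (φ * φ') (θ * θ') := fun x =>
  (congrArg θ.1 (h' x)).trans (h _)

theorem left_unique [Nontrivial M] (hs : IsSimple R) (hc : NoNewConstants k R)
    (hρ : ∀ s, ρ (σ s) = σExt K M B (ρ s)) {φ φ' : galoisPoints k R B} {θ : galoisPoints K M B}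
    (h : Intertwines ρ φ θ) (h' : Intertwines ρ φ' θ) : φ = φ' :=
  galoisPoints_ext fun _ => comparisonHom_injective hs hc hρ ((h _).symm.trans (h' _))

theorem right_unique (hsurj : Function.Surjective (tensorExtend ρ)) {φ : galoisPoints k R B}
    {θ θ' : galoisPoints K M B} (h : Intertwines ρ φ θ) (h' : Intertwines ρ φ θ') : θ = θ' := by
  have hρ : θ.1.toAlgHom.comp ρ = θ'.1.toAlgHom.comp ρ := BaseChange.algHom_ext fun r => by
    have hr := (h (r ⊗ₜ 1)).trans (h' (r ⊗ₜ 1)).symm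
    rwa [comparisonHom_tmul_one] at hr
  exact galoisPoints_ext_of_surjective hsurj (DFunLike.congr_fun hρ)

theorem galoisMap {B' : Type u} [CommRing B'] [Algebra (constants k) B']
    [Algebra (constants K) B'] [IsScalarTower (constants k) (constants K) B']
    (g : B →ₐ[constants K] B') {φ : galoisPoints k R B} {θ : galoisPoints K M B}
    (h : Intertwines ρ φ θ) : Intertwines ((tensorMap M g).comp ρ)
      (DifferenceRing.galoisMap (g.restrictScalars (constants k)) φ)
      (DifferenceRing.galoisMap g θ) := by
  refine of_tmul_one fun r => ?_
  rw [galoisMap_tmul_one, comparisonHom_tensorMap, ← h, comparisonHom_tmul_one]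
  exact extendHom_tensorMap g θ _

variable {n : ℕ} {A : GL (Fin n) k} [Nontrivial M]

theorem exists_right (hS : IsSimple (BaseChange k K R)) (hcS : NoNewConstants K (BaseChange k K R))
    (hcM : NoNewConstants K M)
    {V : FundamentalMatrix (GeneralLinearGroup.map (algebraMap k K) A) M} (hV : V.ring = ⊤)
    (Z : FundamentalMatrix A R) (hρ : ∀ s, ρ (σ s) = σExt K M B (ρ s)) (φ : galoisPoints k R B) :
    ∃ θ, Intertwines ρ φ θ := by
  let ψ : BaseChange k K R →ₐ[K] M ⊗[constants K] B := BaseChange.lift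
    ((comparisonHom ρ).comp (φ.1.toAlgHom.comp Algebra.TensorProduct.includeLeft))
  have hψ (s) : ψ (σ s) = σExt K M B (ψ s) := by
    refine BaseChange.lift_σ (τ := (σExt K M B : M ⊗[constants K] B →+* M ⊗[constants K] B))
      (fun a => congrArg (· ⊗ₜ 1) (Extension.σ_algebraMap a)) (fun r => ?_) s
    refine Eq.trans ?_ (comparisonHom_σExt hρ (φ.1 (r ⊗ₜ 1)))
    rw [← φ.2.2]
    rfl
  have hbij {ρ : BaseChange k K R →ₐ[K] M ⊗[constants K] B} :=
    tensorExtend_bijective (ρ := ρ) hS hcS hcM hV (Z.baseChange K)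
  obtain ⟨θ, hθ⟩ := exists_galoisPoint_map_eq hρ (hbij hρ) hψ (hbij hψ)
  exact ⟨θ, of_tmul_one fun r => (hθ _).trans (BaseChange.lift_incl _ r)⟩

theorem exists_comparisonHom_eq (hR : IsPicardVessiotRing A R) (hc : NoNewConstants k R)
    (hρ : ∀ s, ρ (σ s) = σExt K M B (ρ s)) {ψ : R →ₐ[k] M ⊗[constants K] B}
    (hψ : ∀ r, ψ (σ r) = σExt K M B (ψ r)) (hle : ψ.range ≤ (comparisonHom ρ).range) :
    ∃ φ : galoisPoints k R B, ∀ r, comparisonHom ρ (φ.1 (r ⊗ₜ 1)) = ψ r := by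
  have hinj := comparisonHom_injective hR.2 hc hρ
  obtain ⟨ψ', hψ'⟩ := exists_comp_eq_of_range_le hinj hle
  have hψ'_apply (r : R) : comparisonHom ρ (ψ' r) = ψ r := DFunLike.congr_fun hψ' r
  obtain ⟨φ, hφ⟩ := exists_galoisPoint hR hc (ρ := ψ') fun r => hinj <| by
    rw [comparisonHom_σExt hρ, hψ'_apply, hψ'_apply, hψ]
  exact ⟨φ, fun r => by rw [hφ, hψ'_apply]⟩

theorem exists_left (hR : IsPicardVessiotRing A R) (hc : NoNewConstants k R)
    (V : FundamentalMatrix (GeneralLinearGroup.map (algebraMap k K) A) M)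
    (hcM : NoNewConstants K M) (hρ : ∀ s, ρ (σ s) = σExt K M B (ρ s)) (θ : galoisPoints K M B) :
    ∃ φ : galoisPoints k R B, Intertwines ρ φ θ := by
  obtain ⟨Z, hZ⟩ := hR.1
  have hθ (s) : θ.1.toAlgHom.comp ρ (σ s) = σExt K M B (θ.1.toAlgHom.comp ρ s) :=
    (congrArg θ.1 (hρ s)).trans (θ.2.2 _)
  obtain ⟨P, hP⟩ := (Z.baseChange K).exists_map_eq_mul V hcM hρ
  obtain ⟨P', hP'⟩ := (Z.baseChange K).exists_map_eq_mul V hcM hθ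
  let ψ : R →ₐ[k] M ⊗[constants K] B :=
    ((θ.1.toAlgHom.comp ρ).restrictScalars k).comp (BaseChange.incl k K R)
  have hψ : GeneralLinearGroup.map (ψ : R →+* M ⊗[constants K] B) Z.mat = _ := hP'
  have hρX (r : R) : ρ (BaseChange.incl k K R r) ∈ (comparisonHom ρ).range :=
    ⟨r ⊗ₜ 1, comparisonHom_tmul_one ρ r⟩
  have hBX (b : B) : (1 : M) ⊗ₜ b ∈ (comparisonHom ρ).range :=
    ⟨1 ⊗ₜ b, comparisonHom_one_tmul ρ b⟩
  have hle : ψ.range ≤ (comparisonHom ρ).range := FundamentalMatrix.range_le hZ <| by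
    rw [hψ, ← mul_inv_eq_of_eq_mul hP]
    exact mul_mem (mul_mem (map_mem_range_map_val (f := (ρ : _ →+* M ⊗[constants K] B).comp
      (BaseChange.incl k K R : R →+* BaseChange k K R)) hρX Z.mat)
      (inv_mem (map_mem_range_map_val hBX P))) (map_mem_range_map_val hBX P')
  obtain ⟨φ, hφ⟩ := exists_comparisonHom_eq hR hc hρ (ψ := ψ)
    (fun r => (congrArg _ (BaseChange.incl_σ r)).trans (hθ _)) hle
  exact ⟨φ, of_tmul_one fun r => (hφ r).symm⟩

end Intertwines

end GaloisComparison

section GaloisIso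

open Matrix

variable {k K R M B : Type u} [Field k] [DifferenceRing k] [Field K] [DifferenceRing K]
  [Algebra k K] [Extension k K] [CommRing R] [DifferenceRing R] [Algebra k R] [Extension k R]
  [CommRing M] [DifferenceRing M] [Algebra k M] [Algebra K M] [Extension K M] [IsScalarTower k K M]
  [Nontrivial M] {n : ℕ} {A : GL (Fin n) k}
  {V : FundamentalMatrix (GeneralLinearGroup.map (algebraMap k K) A) M}

theorem exists_galoisPoints_mulEquiv [CommRing B] [Algebra (constants k) B]
    [Algebra (constants K) B] [IsScalarTower (constants k) (constants K) B]
    (hR : IsPicardVessiotRing A R) (hc : NoNewConstants k R) (hS : IsSimple (BaseChange k K R))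
    (hcS : NoNewConstants K (BaseChange k K R)) (hcM : NoNewConstants K M) (hV : V.ring = ⊤)
    {ρ : BaseChange k K R →ₐ[K] M ⊗[constants K] B} (hρ : ∀ s, ρ (σ s) = σExt K M B (ρ s)) :
    ∃ e : galoisPoints k R B ≃* galoisPoints K M B, ∀ φ, Intertwines ρ φ (e φ) := by
  obtain ⟨Z, -⟩ := hR.1
  choose e he using Intertwines.exists_right hS hcS hcM hV Z hρ
  have huniq {φ : galoisPoints k R B} {θ : galoisPoints K M B} (h : Intertwines ρ φ θ) : e φ = θ :=
    (he φ).right_unique (tensorExtend_surjective hcM hV (Z.baseChange K) hρ) h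
  refine ⟨MulEquiv.ofBijective (MonoidHom.mk' e fun φ φ' => huniq ((he φ).mul (he φ')))
    ⟨fun φ φ' h => ?_, fun θ => ?_⟩, he⟩
  · exact (he φ).left_unique hR.2 hc hρ (h.symm.subst (motive := Intertwines ρ φ') (he φ'))
  · exact (Intertwines.exists_left hR hc V hcM hρ θ).imp fun _ => huniq

theorem nonempty_groupBaseChange_iso {F : Type u} [Field F] [Algebra (constants k) F]
    [Algebra (constants K) F] [IsScalarTower (constants k) (constants K) F]
    (hR : IsPicardVessiotRing A R) (hc : NoNewConstants k R) (hS : IsSimple (BaseChange k K R))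
    (hcS : NoNewConstants K (BaseChange k K R)) (hcM : NoNewConstants K M) (hV : V.ring = ⊤)
    {ρ : BaseChange k K R →ₐ[K] M ⊗[constants K] F} (hρ : ∀ s, ρ (σ s) = σExt K M F (ρ s)) :
    Nonempty (groupBaseChange F (galoisGroup k R) ≅ groupBaseChange F (galoisGroup K M)) := by
  obtain ⟨Z, -⟩ := hR.1
  let algk (B : CommAlgCat.{u} F) : Algebra (constants k) B :=
    Algebra.compHom B (algebraMap (constants k) F)
  let algK (B : CommAlgCat.{u} F) : Algebra (constants K) B :=
    Algebra.compHom B (algebraMap (constants K) F)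
  have tower (B : CommAlgCat.{u} F) : IsScalarTower (constants k) (constants K) B :=
    IsScalarTower.of_algebraMap_eq fun c => congrArg (algebraMap F B)
      (IsScalarTower.algebraMap_apply (constants k) (constants K) F c)
  let f (B : CommAlgCat.{u} F) : F →ₐ[constants K] B :=
    { algebraMap F B with commutes' := fun _ => rfl }
  have hρ' (B : CommAlgCat.{u} F) (s : BaseChange k K R) :
      (tensorMap M (f B)).comp ρ (σ s) = σExt K M B ((tensorMap M (f B)).comp ρ s) :=
    (congrArg _ (hρ s)).trans (tensorMap_σExt (f B) (ρ s))
  choose e he using fun B : CommAlgCat.{u} F =>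
    exists_galoisPoints_mulEquiv hR hc hS hcS hcM hV (hρ' B)
  refine ⟨NatIso.ofComponents (fun B => (e B).toGrpIso) fun {B B'} h => ?_⟩
  let hK : B →ₐ[constants K] B' := ((restrictAlg (constants K) F).map h).hom
  have hf : hK.comp (f B) = f B' := AlgHom.ext fun c => h.hom.commutes c
  refine GrpCat.hom_ext (MonoidHom.ext fun φ => ?_)
  change e B' (galoisMap (hK.restrictScalars (constants k)) φ) = galoisMap hK (e B φ)
  refine (he B' _).right_unique (tensorExtend_surjective hcM hV (Z.baseChange K) (hρ' B')) ?_
  rw [← hf, tensorMap_comp]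
  exact (he B φ).galoisMap hK

end GaloisIso

end DifferenceRing

theorem theorem2p9_general {k : Type u} [Field k] [DifferenceRing k] {n : ℕ} {A : GL (Fin n) k}
    {R : Type u} [CommRing R] [DifferenceRing R] [Algebra k R] [Extension k R]
    (hR : IsPicardVessiotRing A R) (hcR : NoNewConstants k R)
    {K : Type u} [Field K] [DifferenceRing K] [Algebra k K] [Extension k K]
    (hK : IntermediateField.adjoin k (constants K : Set K) = ⊤)
    {L : Type u} [CommRing L] [DifferenceRing L] [Algebra K L] [Extension K L]
    (hL : IsSimple L) (hcL : NoNewConstants K L)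
    (V : FundamentalMatrix (Matrix.GeneralLinearGroup.map (algebraMap k K) A) L)
    (F : Type u) [Field F] [IsAlgClosed F] [Algebra (constants K) F] [Algebra (constants k) F]
    [IsScalarTower (constants k) (constants K) F] :
    (∃ Φ : BaseChange k K R ⊗[constants K] F ≃ₐ[K] V.ring ⊗[constants K] F,
      (∀ c : F, Φ (1 ⊗ₜ c) = 1 ⊗ₜ c) ∧
      (∀ x, Φ (σExt K (BaseChange k K R) F x) = σExt K V.ring F (Φ x)) ∧
      ∃ ι : R ⊗[constants k] F →+* V.ring ⊗[constants K] F,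
        Function.Injective ι ∧
          ∀ (r : R) (c : F), ι (r ⊗ₜ c) = Φ (BaseChange.mk k 1 r ⊗ₜ c)) ∧
    IsPicardVessiotRing (Matrix.GeneralLinearGroup.map (algebraMap k K) A) V.ring ∧
    IsLinearAlgebraicGroup (galoisGroup k R) ∧
    IsLinearAlgebraicGroup (galoisGroup K V.ring) ∧
    Nonempty (groupBaseChange F (galoisGroup k R) ≅
      groupBaseChange F (galoisGroup K V.ring)) := by
  obtain ⟨⟨Z, hZ⟩, hs⟩ := id hR
  have := hs.1
  have := hL.1
  let _ : Algebra k V.ring := Algebra.compHom _ (algebraMap k K)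
  have : IsScalarTower k K V.ring := .of_algebraMap_eq fun _ => rfl
  have hS : IsSimple (BaseChange k K R) := hs.baseChange hcR hK
  have hcS : NoNewConstants K (BaseChange k K R) := .baseChange hs hcR hK
  have hcT : NoNewConstants K V.ring := V.noNewConstants_ring hcL
  obtain ⟨W, hW⟩ := V.exists_ring_eq_top
  obtain ⟨ρ, hρ⟩ := V.exists_equivariant_algHom (F := F) hL hcL (Z.baseChange_ring hZ)
  have hbij := tensorExtend_bijective hS hcS hcT hW (Z.baseChange K) hρ
  have hT : IsPicardVessiotRing _ V.ring :=
    ⟨⟨W, hW⟩, hS.of_tensor hcS hbij.2 (tensorExtend_σExt hρ)⟩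
  exact ⟨⟨AlgEquiv.ofBijective _ hbij, tensorExtend_one_tmul ρ, tensorExtend_σExt hρ,
      comparisonHom ρ, comparisonHom_injective hs hcR hρ, comparisonHom_tmul ρ⟩,
    hT, isLinearAlgebraicGroup_galoisGroup hR hcR, isLinearAlgebraicGroup_galoisGroup hT hcT,
    nonempty_groupBaseChange_iso hR hcR hS hcS hcT hW hρ⟩

theorem theorem2p9
    {k : Type u} [Field k] [CharZero k] [DifferenceRing k] [IsAlgClosed (constants k)]
    {n : ℕ} (A : GL (Fin n) k)
    (R : Type u) [CommRing R] [DifferenceRing R] [Algebra k R] [Extension k R]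
    (hR : IsPicardVessiotRing A R)
    (K : Type u) [Field K] [DifferenceRing K] [Algebra k K] [Extension k K]
    (hK : IntermediateField.adjoin k (constants K : Set K) = ⊤)
    (L : Type u) [Field L] [DifferenceRing L] [Algebra K L] [Extension K L]
    (hL : IsWeakPicardVessiotField (Matrix.GeneralLinearGroup.map (algebraMap k K) A) L)
    (V : FundamentalMatrix (Matrix.GeneralLinearGroup.map (algebraMap k K) A) L)
    (hV : IntermediateField.adjoin K
      (Set.range fun p : Fin n × Fin n => V.mat p.1 p.2) = ⊤)
    (F : Type u) [Field F] [Algebra (constants K) F] [IsAlgClosure (constants K) F]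
    [Algebra (constants k) F] [IsScalarTower (constants k) (constants K) F] :
    (∃ Φ : BaseChange k K R ⊗[constants K] F ≃ₐ[K] V.ring ⊗[constants K] F,
      (∀ c : F, Φ (1 ⊗ₜ c) = 1 ⊗ₜ c) ∧
      (∀ x, Φ (σExt K (BaseChange k K R) F x) = σExt K V.ring F (Φ x)) ∧
      ∃ ι : R ⊗[constants k] F →+* V.ring ⊗[constants K] F,
        Function.Injective ι ∧
          ∀ (r : R) (c : F), ι (r ⊗ₜ c) = Φ (BaseChange.mk k 1 r ⊗ₜ c)) ∧
    IsPicardVessiotRing (Matrix.GeneralLinearGroup.map (algebraMap k K) A) V.ring ∧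
    IsLinearAlgebraicGroup (galoisGroup k R) ∧
    IsLinearAlgebraicGroup (galoisGroup K V.ring) ∧
    Nonempty (groupBaseChange F (galoisGroup k R) ≅
      groupBaseChange F (galoisGroup K V.ring)) := by
  obtain ⟨⟨Z, hZ⟩, hs⟩ := id hR
  have := Z.finiteType hZ
  have := IsAlgClosure.isAlgClosed (K := F) (constants K)
  exact theorem2p9_general hR hs.noNewConstants hK (isSimple_of_field L) hL.1 V F
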